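/- Let $(\Omega,\mathcal P)$ be a probability space and $0<A<B<1$. Let $(a_n,b_n)_{n\ge 1}$ be i.i.d. pairs of random variables with $A\le\min(a_n,b_n)$ and $a_n+b_n\le B$, and let $(p_n)_{n\ge1}$ be i.i.d. random variables with values in $[0,1]$, the sequence $(p_n)$ being independent of the sequence $(a_n,b_n)$, such that $\mathbb E(p_1^{-t})<\infty$ and $\mathbb E((1-p_1)^{-t})<\infty$ for some $t>0$ (with $0^{-t}=\infty$). For each $\omega$ let $[0,1]$ be the only Moran interval of step $0$; each Moran interval $J$ of step $n-1$ has two children of step $n$: the closed subinterval of length $a_n(\omega)|J|$ sharing the left endpoint of $J$ (left child) and the closed subinterval of length $b_n(\omega)|J|$ sharing the right endpoint of $J$ (right child). Let $\mu_\omega$ be the Borel probability measure, carried by the Moran set $C_\omega=\bigcap_n C^{(n)}_\omega$ ($C_\omega^{(n)}$ is the union of the Moran intervals of step $n$), for which the left child of any interval $J$ of step $n-1$ has mass $p_n(\omega)\mu_\omega(J)$ and the right child has mass $(1-p_n(\omega))\mu_\omega(J)$. For $0<\theta<1$ let $\overline{\dim}_{\Phi_\theta}\mu$ be the infimum (and $\underline{\dim}_{\Phi_\theta}\mu$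 the supremum) of the real $d$ for which there are $C_1,C_2>0$ such that $\frac{\mu(B(x,R))}{\mu(B(x,r))}\le C_2 (R/r)^d$ (respectively $\ge C_2(R/r)^d$) for all $0<r<R^{1/\theta}\le R\le C_1$ and all $x\in\operatorname{supp}\mu$. The quasi-Assouad and quasi-lower Assouad dimensions are $\dim_{qA}\mu=\lim_{\theta\to1^-}\overline{\dim}_{\Phi_\theta}\mu$ and $\dim_{qL}\mu=\lim_{\theta\to1^-}\underline{\dim}_{\Phi_\theta}\mu$. For $\psi\ge0$ put $Y(\psi)=\log p_1$, $Z(\psi)=\log a_1$ if $p_1\le \frac{a_1^\psi}{a_1^\psi+b_1^\psi}$ and $Y(\psi)=\log(1-p_1)$, $Z(\psi)=\log b_1$ otherwise; put $Y'(\psi)=\log p_1$, $Z'(\psi)=\log a_1$ if $p_1\ge \frac{a_1^\psi}{a_1^\psi+b_1^\psi}$ and $Y'(\psi)=\log(1-p_1)$, $Z'(\psi)=\log b_1$ otherwise. Let $G(\psi)=\mathbb E(Y(\psi))/\mathbb E(Z(\psi))$ and $G'(\psi)=\mathbb E(Y'(\psi))/\mathbb E(Z'(\psi))$. Then, for every real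 $\psi\ge 0$: (i) if $G(\psi)<\psi$, then $\dim_{qA}\mu_\omega\le\psi$ almost surely; (ii) if $G(\psi)\ge\psi$, then $\dim_{qA}\mu_\omega\ge\psi$ almost surely; (iii) if $G'(\psi)>\psi$, then $\dim_{qL}\mu_\omega\ge\psi$ almost surely; (iv) if $G'(\psi)\le\psi$, then $\dim_{qL}\mu_\omega\le\psi$ almost surely. -/

import Mathlib

open MeasureTheory ProbabilityTheory Filter Topology unitInterval

/-! ### Dimensions of measures -/

/-- `d` is an admissible exponent for the upper `Φ`-dimension of `μ`: there are `C₁, C₂ > 0` with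
`μ(B(x,R)) / μ(B(x,r)) ≤ C₂ (R/r)^d` whenever `0 < r < R^{1+Φ(R)} ≤ R ≤ C₁` and `x ∈ supp μ`. -/
def UpperPhiBound {X : Type*} [PseudoMetricSpace X] [MeasurableSpace X]
    (Φ : ℝ → ℝ) (μ : Measure X) (d : ℝ) : Prop :=
  ∃ C₁ : ℝ, 0 < C₁ ∧ ∃ C₂ : ℝ, 0 < C₂ ∧
    ∀ r R : ℝ, 0 < r → r < R ^ (1 + Φ R) → R ^ (1 + Φ R) ≤ R → R ≤ C₁ →
      ∀ x ∈ μ.support,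
        μ.real (Metric.ball x R) / μ.real (Metric.ball x r) ≤ C₂ * (R / r) ^ d

/-- `d` is an admissible exponent for the lower `Φ`-dimension of `μ`: there are `C₁, C₂ > 0` with
`μ(B(x,R)) / μ(B(x,r)) ≥ C₂ (R/r)^d` whenever `0 < r < R^{1+Φ(R)} ≤ R ≤ C₁` and `x ∈ supp μ`. -/
def LowerPhiBound {X : Type*} [PseudoMetricSpace X] [MeasurableSpace X]
    (Φ : ℝ → ℝ) (μ : Measure X) (d : ℝ) : Prop :=
  ∃ C₁ : ℝ, 0 < C₁ ∧ ∃ C₂ : ℝ, 0 < C₂ ∧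
    ∀ r R : ℝ, 0 < r → r < R ^ (1 + Φ R) → R ^ (1 + Φ R) ≤ R → R ≤ C₁ →
      ∀ x ∈ μ.support,
        C₂ * (R / r) ^ d ≤ μ.real (Metric.ball x R) / μ.real (Metric.ball x r)

/-- The upper `Φ`-dimension of a finite measure (the infimum of the empty set is `+∞`). -/
noncomputable def upperPhiDim {X : Type*} [PseudoMetricSpace X] [MeasurableSpace X]
    (Φ : ℝ → ℝ) (μ : Measure X) : EReal :=
  sInf ((fun d : ℝ => (d : EReal)) '' {d : ℝ | UpperPhiBound Φ μ d})

/-- The lower `Φ`-dimension of a finite measure. -/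
noncomputable def lowerPhiDim {X : Type*} [PseudoMetricSpace X] [MeasurableSpace X]
    (Φ : ℝ → ℝ) (μ : Measure X) : EReal :=
  sSup ((fun d : ℝ => (d : EReal)) '' {d : ℝ | LowerPhiBound Φ μ d})

/-- The constant dimension function `Φ_θ = 1/θ - 1`. -/
noncomputable def phiTheta (θ : ℝ) : ℝ → ℝ := fun _ => 1 / θ - 1

/-- The quasi-Assouad dimension: the limit of the upper `Φ_θ`-dimensions as `θ → 1⁻`. -/
noncomputable def quasiAssouadDim {X : Type*} [PseudoMetricSpace X] [MeasurableSpace X]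
    (μ : Measure X) : EReal :=
  limUnder (𝓝[<] (1 : ℝ)) (fun θ => upperPhiDim (phiTheta θ) μ)

/-- The quasi-lower Assouad dimension: the limit of the lower `Φ_θ`-dimensions as `θ → 1⁻`. -/
noncomputable def quasiLowerAssouadDim {X : Type*} [PseudoMetricSpace X] [MeasurableSpace X]
    (μ : Measure X) : EReal :=
  limUnder (𝓝[<] (1 : ℝ)) (fun θ => lowerPhiDim (phiTheta θ) μ)

/-- For `0 < s ≤ t < 1` the range of radii for `Φ_s` is contained in the one for `Φ_t`. -/
theorem phiTheta_range {s t r R : ℝ} (hs : 0 < s) (hst : s ≤ t) (ht : t < 1) (hr : 0 < r)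
    (h1 : r < R ^ (1 + phiTheta s R)) (h2 : R ^ (1 + phiTheta s R) ≤ R) :
    r < R ^ (1 + phiTheta t R) ∧ R ^ (1 + phiTheta t R) ≤ R := by
  have hR : 0 < R := hr.trans (h1.trans_le h2)
  have hs1 : s < 1 := hst.trans_lt ht
  have e1 : (1 : ℝ) < 1 / s := by rw [lt_div_iff₀ hs]; linarith
  have e2 : (1 : ℝ) < 1 / t := by rw [lt_div_iff₀ (hs.trans_le hst)]; linarith
  have e3 : 1 / t ≤ 1 / s := one_div_le_one_div_of_le hs hst
  have hR1 : R ≤ 1 := by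
    by_contra hc
    push Not at hc
    have := Real.rpow_lt_rpow_of_exponent_lt hc (show (1 : ℝ) < 1 + phiTheta s R by
      simp only [phiTheta]; linarith)
    rw [Real.rpow_one] at this
    linarith
  constructor
  · refine h1.trans_le (Real.rpow_le_rpow_of_exponent_ge hR hR1 ?_)
    simp only [phiTheta]; linarith
  · calc R ^ (1 + phiTheta t R) ≤ R ^ (1 : ℝ) :=
          Real.rpow_le_rpow_of_exponent_ge hR hR1 (by simp only [phiTheta]; linarith)
      _ = R := Real.rpow_one R

/-- The limit defining the quasi-Assouad dimension exists. -/
theorem tendsto_quasiAssouadDim {X : Type*} [PseudoMetricSpace X] [MeasurableSpace X]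
    (μ : Measure X) :
    Tendsto (fun θ => upperPhiDim (phiTheta θ) μ) (𝓝[<] (1 : ℝ)) (𝓝 (quasiAssouadDim μ)) := by
  have hmono : MonotoneOn (fun θ => upperPhiDim (phiTheta θ) μ) (Set.Ioo (0 : ℝ) 1) := by
    intro s hs t ht hst
    refine sInf_le_sInf (Set.image_mono ?_)
    rintro d ⟨C₁, h1, C₂, h2, h⟩
    refine ⟨C₁, h1, C₂, h2, fun r R hr hrR hR hC x hx => ?_⟩
    obtain ⟨k1, k2⟩ := phiTheta_range hs.1 hst ht.2 hr hrR hR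
    exact h r R hr k1 k2 hC x hx
  exact tendsto_nhds_limUnder
    ⟨_, hmono.tendsto_nhdsWithin_Ioo_left ⟨1 / 2, by norm_num⟩ (OrderTop.bddAbove _)⟩

/-- The limit defining the quasi-lower Assouad dimension exists. -/
theorem tendsto_quasiLowerAssouadDim {X : Type*} [PseudoMetricSpace X] [MeasurableSpace X]
    (μ : Measure X) :
    Tendsto (fun θ => lowerPhiDim (phiTheta θ) μ) (𝓝[<] (1 : ℝ))
      (𝓝 (quasiLowerAssouadDim μ)) := by
  have hanti : AntitoneOn (fun θ => lowerPhiDim (phiTheta θ) μ) (Set.Ioo (0 : ℝ) 1) := by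
    intro s hs t ht hst
    refine sSup_le_sSup (Set.image_mono ?_)
    rintro d ⟨C₁, h1, C₂, h2, h⟩
    refine ⟨C₁, h1, C₂, h2, fun r R hr hrR hR hC x hx => ?_⟩
    obtain ⟨k1, k2⟩ := phiTheta_range hs.1 hst ht.2 hr hrR hR
    exact h r R hr k1 k2 hC x hx
  exact tendsto_nhds_limUnder
    ⟨_, hanti.tendsto_nhdsWithin_Ioo_left ⟨1 / 2, by norm_num⟩ (OrderBot.bddBelow _)⟩

/-! ### Moran sets and Moran measures

Levels are indexed from `0`: the data `a n, b n, p n` are used in passing from step `n` to step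
`n + 1`. An infinite word `v : ℕ → Bool` codes a branch (`false`: left child, `true`: right child),
and the Moran interval of step `n` on that branch depends on the first `n` letters of `v` only. -/

/-- Length of the Moran interval of step `n` on the branch `v`. -/
noncomputable def moranLength (a b : ℕ → ℝ) (v : ℕ → Bool) : ℕ → ℝ
  | 0 => 1
  | n + 1 => (if v n then b n else a n) * moranLength a b v n

/-- Left endpoint of the Moran interval of step `n` on the branch `v`: the left child shares the
left endpoint of its parent, the right child shares the right endpoint. -/
noncomputable def moranLeft (a b : ℕ → ℝ) (v : ℕ → Bool) : ℕ → ℝ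
  | 0 => 0
  | n + 1 => moranLeft a b v n + (if v n then (1 - b n) * moranLength a b v n else 0)

/-- The Moran interval of step `n` on the branch `v`. -/
def moranInterval (a b : ℕ → ℝ) (v : ℕ → Bool) (n : ℕ) : Set ℝ :=
  Set.Icc (moranLeft a b v n) (moranLeft a b v n + moranLength a b v n)

/-- The Moran set `C = ⋂ₙ C⁽ⁿ⁾`, with `C⁽ⁿ⁾` the union of the Moran intervals of step `n`. -/
def moranSet (a b : ℕ → ℝ) : Set ℝ :=
  ⋂ n : ℕ, ⋃ v : ℕ → Bool, moranInterval a b v n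

/-- The point of the Moran set on the branch `v`, that is the limit of the nondecreasing sequence of
left endpoints of the Moran intervals along `v`. -/
noncomputable def moranPoint (a b : ℕ → ℝ) (v : ℕ → Bool) : ℝ :=
  ⨆ n : ℕ, moranLeft a b v n

/-- The Moran measure: the law of the point on a random branch which, independently at each step
`n`, goes left with probability `p n` and right with probability `1 - p n`. It is the probability
measure on the line giving the children of an interval `I` of step `n` the masses `p n * μ(I)`
(left) and `(1 - p n) * μ(I)` (right), see `moranMeasure_left`, `moranMeasure_right`. -/
noncomputable def moranMeasure (a b : ℕ → ℝ) (p : ℕ → I) : Measure ℝ :=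
  (Measure.infinitePi (fun n => bernoulliMeasure false true (p n))).map (moranPoint a b)

section MoranFacts

variable {a b : ℕ → ℝ}

theorem moranLength_pos (h : ∀ n, 0 < a n ∧ 0 < b n ∧ a n + b n < 1) (v : ℕ → Bool) (n : ℕ) :
    0 < moranLength a b v n := by
  induction n with
  | zero => simp [moranLength]
  | succ n ih =>
    rw [moranLength]
    split_ifs
    · exact mul_pos (h n).2.1 ih
    · exact mul_pos (h n).1 ih

theorem moranLeft_le_succ (h : ∀ n, 0 < a n ∧ 0 < b n ∧ a n + b n < 1) (v : ℕ → Bool) (n : ℕ) :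
    moranLeft a b v n ≤ moranLeft a b v (n + 1) := by
  have hl := moranLength_pos h v n
  obtain ⟨h1, h2, h3⟩ := h n
  rw [moranLeft]
  split_ifs
  · nlinarith
  · simp

theorem moranRight_succ_le (h : ∀ n, 0 < a n ∧ 0 < b n ∧ a n + b n < 1) (v : ℕ → Bool) (n : ℕ) :
    moranLeft a b v (n + 1) + moranLength a b v (n + 1)
      ≤ moranLeft a b v n + moranLength a b v n := by
  have hl := moranLength_pos h v n
  obtain ⟨h1, h2, h3⟩ := h n
  rw [moranLeft, moranLength]
  split_ifs
  · nlinarith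
  · nlinarith

theorem moranInterval_antitone (h : ∀ n, 0 < a n ∧ 0 < b n ∧ a n + b n < 1) (v : ℕ → Bool) :
    Antitone (moranInterval a b v) :=
  antitone_nat_of_succ_le fun n =>
    Set.Icc_subset_Icc (moranLeft_le_succ h v n) (moranRight_succ_le h v n)

theorem moranPoint_mem (h : ∀ n, 0 < a n ∧ 0 < b n ∧ a n + b n < 1) (v : ℕ → Bool) (n : ℕ) :
    moranPoint a b v ∈ moranInterval a b v n := by
  have key : ∀ m k, moranLeft a b v m ≤ moranLeft a b v k + moranLength a b v k := by
    intro m k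
    have h1 : moranLeft a b v m ≤ moranLeft a b v (max m k) :=
      monotone_nat_of_le_succ (moranLeft_le_succ h v) (le_max_left m k)
    have h2 := antitone_nat_of_succ_le (f := fun n => moranLeft a b v n + moranLength a b v n)
      (moranRight_succ_le h v) (le_max_right m k)
    have h3 := moranLength_pos h v (max m k)
    simp only at h2
    linarith
  exact ⟨le_ciSup ⟨_, Set.forall_mem_range.2 fun m => key m n⟩ n, ciSup_le fun m => key m n⟩

theorem moranLeft_congr {v w : ℕ → Bool} {n : ℕ} (hvw : ∀ i < n, v i = w i) :
    moranLeft a b v n = moranLeft a b w n ∧ moranLength a b v n = moranLength a b w n := by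
  induction n with
  | zero => simp [moranLeft, moranLength]
  | succ n ih =>
    obtain ⟨h1, h2⟩ := ih fun i hi => hvw i (by omega)
    simp [moranLeft, moranLength, h1, h2, hvw n (by omega)]

theorem moranInterval_congr {v w : ℕ → Bool} {n : ℕ} (hvw : ∀ i < n, v i = w i) :
    moranInterval a b v n = moranInterval a b w n := by
  obtain ⟨h1, h2⟩ := moranLeft_congr (a := a) (b := b) hvw
  simp [moranInterval, h1, h2]

/-- The two children of a Moran interval are disjoint. -/
theorem moranInterval_disjoint (h : ∀ n, 0 < a n ∧ 0 < b n ∧ a n + b n < 1) {v w : ℕ → Bool}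
    {n : ℕ} (hvw : ∀ i < n, v i = w i) (hv : v n = false) (hw : w n = true) :
    Disjoint (moranInterval a b v (n + 1)) (moranInterval a b w (n + 1)) := by
  obtain ⟨h1, h2⟩ := moranLeft_congr (a := a) (b := b) hvw
  have hl := moranLength_pos h w n
  obtain ⟨k1, k2, k3⟩ := h n
  rw [Set.disjoint_left]
  intro x hx hy
  simp only [moranInterval, moranLeft, moranLength, hv, hw, h1, h2, Set.mem_Icc] at hx hy
  norm_num at hx hy
  nlinarith [hx.2, hy.1]

theorem moranPoint_preimage (h : ∀ n, 0 < a n ∧ 0 < b n ∧ a n + b n < 1) (v : ℕ → Bool) (n : ℕ) :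
    moranPoint a b ⁻¹' moranInterval a b v n
      = Set.pi (Finset.range n : Set ℕ) (fun i => {v i}) := by
  ext w
  simp only [Set.mem_preimage, Set.mem_pi, Finset.coe_range, Set.mem_Iio, Set.mem_singleton_iff]
  constructor
  · intro hw
    by_contra hc
    push Not at hc
    classical
    obtain ⟨hk, hne⟩ := Nat.find_spec hc
    set k := Nat.find hc with hkdef
    have hlt : ∀ i < k, w i = v i := fun i hi => by
      have := Nat.find_min hc hi
      push Not at this
      exact this (hi.trans hk)
    have m1 := moranPoint_mem h w (k + 1)
    have m2 := moranInterval_antitone h v (show k + 1 ≤ n by omega) hw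
    cases hwk : w k <;> cases hvk : v k
    · exact hne (hwk.trans hvk.symm)
    · exact Set.disjoint_left.1 (moranInterval_disjoint h hlt hwk hvk) m1 m2
    · exact Set.disjoint_left.1
        (moranInterval_disjoint h (fun i hi => (hlt i hi).symm) hvk hwk) m2 m1
    · exact hne (hwk.trans hvk.symm)
  · intro hw
    rw [← moranInterval_congr hw]
    exact moranPoint_mem h w n

theorem measurable_moranPoint : Measurable (moranPoint a b) := by
  have hlen : ∀ n, Measurable fun v : ℕ → Bool => moranLength a b v n := by
    intro n
    induction n with
    | zero => simp only [moranLength]; exact measurable_const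
    | succ n ih =>
      simp only [moranLength]
      exact (Measurable.comp (measurable_of_finite fun c : Bool => if c then b n else a n)
        (measurable_pi_apply n)).mul ih
  have hleft : ∀ n, Measurable fun v : ℕ → Bool => moranLeft a b v n := by
    intro n
    induction n with
    | zero => simp only [moranLeft]; exact measurable_const
    | succ n ih =>
      simp only [moranLeft]
      refine ih.add (Measurable.ite ?_ ((hlen n).const_mul _) measurable_const)
      exact measurableSet_eq_fun (measurable_pi_apply n) measurable_const
  exact Measurable.iSup hleft

instance isProbabilityMeasure_moranMeasure (p : ℕ → I) :
    IsProbabilityMeasure (moranMeasure a b p) :=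
  Measure.isProbabilityMeasure_map measurable_moranPoint.aemeasurable

theorem moranMeasure_interval (h : ∀ n, 0 < a n ∧ 0 < b n ∧ a n + b n < 1) (p : ℕ → I)
    (v : ℕ → Bool) (n : ℕ) :
    moranMeasure a b p (moranInterval a b v n)
      = ∏ i ∈ Finset.range n, ENNReal.ofReal (if v i then 1 - (p i : ℝ) else p i) := by
  have hm : MeasurableSet (moranInterval a b v n) := measurableSet_Icc
  rw [moranMeasure, Measure.map_apply measurable_moranPoint hm, moranPoint_preimage h, Measure.infinitePi_pi _ (fun i _ => measurableSet_singleton _)]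
  refine Finset.prod_congr rfl fun i _ => ?_
  cases v i
  · rw [bernoulliMeasure_apply_of_mem_of_notMem _ (measurableSet_singleton _)
      (Set.mem_singleton _) (by simp)]
    simp [ENNReal.ofReal, Real.toNNReal_of_nonneg (p i).2.1, unitInterval.toNNReal]
    rfl
  · rw [bernoulliMeasure_apply_of_notMem_of_mem _ (measurableSet_singleton _)
      (by simp) (Set.mem_singleton _)]
    have h1 : (0 : ℝ) ≤ 1 - p i := sub_nonneg.2 (p i).2.2
    simp [ENNReal.ofReal, Real.toNNReal_of_nonneg h1, unitInterval.toNNReal]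
    rfl

/-- The left child of an interval of step `n` gets the proportion `p n` of its mass. -/
theorem moranMeasure_left (h : ∀ n, 0 < a n ∧ 0 < b n ∧ a n + b n < 1) (p : ℕ → I)
    (v : ℕ → Bool) (n : ℕ) (hv : v n = false) :
    moranMeasure a b p (moranInterval a b v (n + 1))
      = ENNReal.ofReal (p n) * moranMeasure a b p (moranInterval a b v n) := by
  rw [moranMeasure_interval h, moranMeasure_interval h, Finset.prod_range_succ, hv, mul_comm]
  simp

/-- The right child of an interval of step `n` gets the proportion `1 - p n` of its mass. -/
theorem moranMeasure_right (h : ∀ n, 0 < a n ∧ 0 < b n ∧ a n + b n < 1) (p : ℕ → I)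
    (v : ℕ → Bool) (n : ℕ) (hv : v n = true) :
    moranMeasure a b p (moranInterval a b v (n + 1))
      = ENNReal.ofReal (1 - (p n : ℝ)) * moranMeasure a b p (moranInterval a b v n) := by
  rw [moranMeasure_interval h, moranMeasure_interval h, Finset.prod_range_succ, hv, mul_comm]
  simp

/-- Every branch point lies in the Moran set, so that the Moran measure is carried by that set. -/
theorem moranPoint_mem_moranSet (h : ∀ n, 0 < a n ∧ 0 < b n ∧ a n + b n < 1) (v : ℕ → Bool) :
    moranPoint a b v ∈ moranSet a b :=
  Set.mem_iInter.2 fun n => Set.mem_iUnion.2 ⟨v, moranPoint_mem h v n⟩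

end MoranFacts

/-! ### The threshold functions -/

/-- `Y(θ)`: equals `log p` if `p ≤ a^θ / (a^θ + b^θ)` and `log (1 - p)` otherwise. -/
noncomputable def thresholdY (θ a b p : ℝ) : ℝ :=
  if p ≤ a ^ θ / (a ^ θ + b ^ θ) then Real.log p else Real.log (1 - p)

/-- `Z(θ)`: equals `log a` if `p ≤ a^θ / (a^θ + b^θ)` and `log b` otherwise. -/
noncomputable def thresholdZ (θ a b p : ℝ) : ℝ :=
  if p ≤ a ^ θ / (a ^ θ + b ^ θ) then Real.log a else Real.log b

/-- `Y'(θ)`: equals `log p` if `p ≥ a^θ / (a^θ + b^θ)` and `log (1 - p)` otherwise. -/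
noncomputable def thresholdY' (θ a b p : ℝ) : ℝ :=
  if a ^ θ / (a ^ θ + b ^ θ) ≤ p then Real.log p else Real.log (1 - p)

/-- `Z'(θ)`: equals `log a` if `p ≥ a^θ / (a^θ + b^θ)` and `log b` otherwise. -/
noncomputable def thresholdZ' (θ a b p : ℝ) : ℝ :=
  if a ^ θ / (a ^ θ + b ^ θ) ≤ p then Real.log a else Real.log b

/-- `G(θ) = 𝔼[Y(θ)] / 𝔼[Z(θ)]` for random variables `a, b, p`. -/
noncomputable def thresholdG {Ω : Type*} [MeasurableSpace Ω] (P : Measure Ω)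
    (a b : Ω → ℝ) (p : Ω → I) (θ : ℝ) : ℝ :=
  (∫ ω, thresholdY θ (a ω) (b ω) (p ω) ∂P) / (∫ ω, thresholdZ θ (a ω) (b ω) (p ω) ∂P)

/-- `G'(θ) = 𝔼[Y'(θ)] / 𝔼[Z'(θ)]` for random variables `a, b, p`. -/
noncomputable def thresholdG' {Ω : Type*} [MeasurableSpace Ω] (P : Measure Ω)
    (a b : Ω → ℝ) (p : Ω → I) (θ : ℝ) : ℝ :=
  (∫ ω, thresholdY' θ (a ω) (b ω) (p ω) ∂P) / (∫ ω, thresholdZ' θ (a ω) (b ω) (p ω) ∂P)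

/-!
Put `f l q = ψ log l - log q`. An exponent `ψ` bounds the quotients `μ(B(x,R)) / μ(B(x,r))` from
above or from below according to how `f` changes between the lengths and masses of the Moran
intervals of sizes about `R` and `r` around `x`, because the gap `(1 - B)|J|` between the two
children of an interval `J` makes balls and intervals comparable up to constant factors. The
function `f` is additive along a branch, so its change is at most the sum over the steps between
the two intervals of the maximum of `f` over the two children, and this sum is attained by the
branch that picks the maximising child at every step; the minimum governs the lower dimension in
the same way. Comparing `p` with `a ^ ψ / (a ^ ψ + b ^ ψ)` is exactly comparing the values of `f`
at the two children, so the maximum is `ψ Z - Y` and the minimum is `ψ Z' - Y'`; since `𝔼 Z` and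
`𝔼 Z'` are negative, the position of `G` or `G'` relative to `ψ` is the sign of the expectation of
that maximum or minimum. The restriction `r < R ^ (1 / θ)` keeps the number of steps between the
two intervals proportional to the number of steps before them, so the law of large numbers lets
the sign of the expectation decide the sign of the sum (up to a sublinear error if the expectation
vanishes).
-/

/-! ### Sequences with convergent averages -/

section Averages

variable {S D : ℕ → ℝ} {m : ℝ}

theorem eventually_abs_sub_mul_le_of_tendsto_div
    (hS : Tendsto (fun n : ℕ => S n / n) atTop (𝓝 m)) {δ : ℝ} (hδ : 0 < δ) :
    ∀ᶠ n : ℕ in atTop, |S n - n * m| ≤ δ * n := by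
  filter_upwards [Metric.tendsto_nhds.1 hS δ hδ, eventually_gt_atTop 0] with n hdist hpos
  have hn : (0 : ℝ) < n := Nat.cast_pos.2 hpos
  calc |S n - n * m| = |S n / n - m| * n := by
        rw [← abs_of_pos hn, ← abs_mul, abs_of_pos hn, sub_mul, div_mul_cancel₀ _ hn.ne',
          mul_comm m]
    _ ≤ δ * n := by
        rw [Real.dist_eq] at hdist
        gcongr

theorem eventually_forall_le_of_tendsto_div_neg
    (hS : Tendsto (fun n : ℕ => S n / n) atTop (𝓝 m)) (hm : m < 0) {c : ℝ} (hc : 0 < c) :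
    ∀ᶠ n : ℕ in atTop, ∀ N : ℕ, n ≤ N → c * n ≤ (N : ℝ) - n → S N ≤ S n := by
  set δ := -m * c / (c + 2) with hδ
  have hδ_pos : 0 < δ := div_pos (mul_pos (neg_pos.2 hm) hc) (by positivity)
  filter_upwards [eventually_forall_ge_atTop.2
    (eventually_abs_sub_mul_le_of_tendsto_div hS hδ_pos)] with n hn N hnN hcN
  have hn_lower := (abs_le.1 (hn n le_rfl)).1
  have hN_upper := (abs_le.1 (hn N hnN)).2
  have herror : δ * (N + n) ≤ -m * (N - n) := by
    rw [hδ, div_mul_eq_mul_div, div_le_iff₀ (by positivity), mul_assoc, mul_assoc]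
    exact mul_le_mul_of_nonneg_left (by linarith) (neg_nonneg.2 hm.le)
  linarith

theorem eventually_forall_le_of_tendsto_div_pos
    (hS : Tendsto (fun n : ℕ => S n / n) atTop (𝓝 m)) (hm : 0 < m) {c : ℝ} (hc : 0 < c) :
    ∀ᶠ n : ℕ in atTop, ∀ N : ℕ, n ≤ N → c * n ≤ (N : ℝ) - n → S n ≤ S N := by
  have hS_neg : Tendsto (fun n : ℕ => -S n / n) atTop (𝓝 (-m)) := by
    simpa only [neg_div] using hS.neg
  filter_upwards [eventually_forall_le_of_tendsto_div_neg hS_neg (neg_lt_zero.2 hm) hc]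
    with n hn N hnN hcN
  exact neg_le_neg_iff.1 (hn N hnN hcN)

theorem eventually_neg_mul_le_sub_of_tendsto_div
    (hS : Tendsto (fun n : ℕ => S n / n) atTop (𝓝 m)) (hm : 0 ≤ m) (K : ℕ) {ε : ℝ}
    (hε : 0 < ε) : ∀ᶠ n : ℕ in atTop, -(ε * n) ≤ S (n + K * n) - S n := by
  have hδ : 0 < ε / (K + 2) := by positivity
  filter_upwards [eventually_forall_ge_atTop.2
    (eventually_abs_sub_mul_le_of_tendsto_div hS hδ)] with n hn
  have hn_upper := (abs_le.1 (hn n le_rfl)).2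
  have hN_lower := (abs_le.1 (hn (n + K * n) (Nat.le_add_right _ _))).1
  push_cast at hN_lower
  have herror : ε / (K + 2) * n + ε / (K + 2) * (n + K * n) = ε * n := by field_simp; ring
  have hdrift : 0 ≤ K * n * m := by positivity
  linarith

/-- If `d < ψ`, the gain `(ψ - d) * (D (n + K * n) - D n)` is linear in `n`, hence beats both the
constant and the sublinear decrease of `S`. -/
theorem le_of_eventually_sub_add_mul_le {ψ d β c : ℝ} {K : ℕ}
    (hS : Tendsto (fun n : ℕ => S n / n) atTop (𝓝 m)) (hm : 0 ≤ m) (hβ : 0 < β) (hK : 0 < K)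
    (hD : ∀ n, K * n * β ≤ D (n + K * n) - D n)
    (hle : ∀ᶠ n in atTop, S (n + K * n) - S n + ψ * (D (n + K * n) - D n)
      ≤ c + d * (D (n + K * n) - D n)) : ψ ≤ d := by
  by_contra! hdψ
  have hgap : 0 < ψ - d := sub_pos.2 hdψ
  have hε : 0 < (ψ - d) * (K * β) / 2 := by positivity
  obtain ⟨n, hSn, hlen, hcn⟩ := ((eventually_neg_mul_le_sub_of_tendsto_div hS hm K hε).and
    (hle.and ((tendsto_natCast_atTop_atTop.const_mul_atTop hε).eventually_gt_atTop c))).exists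
  have hgain := mul_le_mul_of_nonneg_left (hD n) hgap.le
  linarith

end Averages

/-! ### Comparison of masses and lengths -/

/-- `log (l ^ ψ / q)`, which compares the mass `q` of a set of diameter `l` with the mass `l ^ ψ`
expected in dimension `ψ`; the logarithm is expanded, so that the quantity is additive along
products of ratios and of weights. -/
noncomputable def logPowDiv (ψ l q : ℝ) : ℝ := ψ * Real.log l - Real.log q

/-- The larger of the values of `logPowDiv` for the two children of an interval of length and mass
`1`. -/
noncomputable def maxLogPowDiv (ψ a b p : ℝ) : ℝ := max (logPowDiv ψ a p) (logPowDiv ψ b (1 - p))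

/-- The smaller of the values of `logPowDiv` for the two children of an interval of length and mass
`1`. -/
noncomputable def minLogPowDiv (ψ a b p : ℝ) : ℝ := min (logPowDiv ψ a p) (logPowDiv ψ b (1 - p))

theorem logPowDiv_mul {ψ l l' q q' : ℝ} (hl : l ≠ 0) (hl' : l' ≠ 0) (hq : q ≠ 0) (hq' : q' ≠ 0) :
    logPowDiv ψ (l * l') (q * q') = logPowDiv ψ l q + logPowDiv ψ l' q' := by
  simp only [logPowDiv, Real.log_mul hl hl', Real.log_mul hq hq']
  ring

theorem div_le_mul_div_rpow_iff {x y R r C d : ℝ} (hx : 0 < x) (hy : 0 < y) (hR : 0 < R)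
    (hr : 0 < r) (hC : 0 < C) :
    x / y ≤ C * (R / r) ^ d
      ↔ Real.log x - Real.log y ≤ Real.log C + d * (Real.log R - Real.log r) := by
  rw [← Real.log_le_log_iff (by positivity) (by positivity), Real.log_div hx.ne' hy.ne',
    Real.log_mul hC.ne' (by positivity), Real.log_rpow (by positivity),
    Real.log_div hR.ne' hr.ne']

theorem mul_div_rpow_le_div_iff {x y R r C d : ℝ} (hx : 0 < x) (hy : 0 < y) (hR : 0 < R)
    (hr : 0 < r) (hC : 0 < C) :
    C * (R / r) ^ d ≤ x / y
      ↔ Real.log C + d * (Real.log R - Real.log r) ≤ Real.log x - Real.log y := by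
  rw [← Real.log_le_log_iff (by positivity) (by positivity), Real.log_div hx.ne' hy.ne',
    Real.log_mul hC.ne' (by positivity), Real.log_rpow (by positivity),
    Real.log_div hR.ne' hr.ne']

theorem one_div_sub_one_pos {θ : ℝ} (hθ : 0 < θ) (hθ_one : θ < 1) : 0 < 1 / θ - 1 :=
  sub_pos.2 ((one_lt_div hθ).2 hθ_one)

theorem abs_log_sub_log_le_log {x y k : ℝ} (hx : 0 < x) (hy : 0 < y) (hxy : x ≤ k * y)
    (hyx : y ≤ k * x) : |Real.log x - Real.log y| ≤ Real.log k := by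
  have hk : k ≠ 0 := by
    rintro rfl
    linarith
  have hlog_x := Real.log_le_log hx hxy
  have hlog_y := Real.log_le_log hy hyx
  rw [Real.log_mul hk hy.ne'] at hlog_x
  rw [Real.log_mul hk hx.ne'] at hlog_y
  exact abs_sub_le_iff.2 ⟨by linarith, by linarith⟩

theorem abs_mul_sub_sub_le {ψ x x' y y' K : ℝ} (hx : |x - x'| ≤ K) (hy : |y - y'| ≤ K) :
    |ψ * (x - y) - ψ * (x' - y')| ≤ 2 * K * |ψ| := by
  calc |ψ * (x - y) - ψ * (x' - y')| = |ψ| * |(x - x') - (y - y')| := by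
        rw [← abs_mul]
        ring_nf
    _ ≤ |ψ| * (K + K) := by
        gcongr
        exact (abs_sub _ _).trans (add_le_add hx hy)
    _ = 2 * K * |ψ| := by ring

/-! ### Geometry and mass of Moran intervals -/

/-- The region for the scaling ratios: `A ≤ min (a, b)` and `a + b ≤ B`, with `0 < A` and
`B < 1`. -/
structure MoranBounds (A B : ℝ) (a b : ℕ → ℝ) : Prop where
  pos : 0 < A
  lt_one : B < 1
  le_min : ∀ n, A ≤ min (a n) (b n)
  add_le : ∀ n, a n + b n ≤ B

/-- The scaling ratio used by the branch `v` in passing from step `n` to step `n + 1`. -/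
def moranRatio (a b : ℕ → ℝ) (v : ℕ → Bool) (n : ℕ) : ℝ := if v n then b n else a n

/-- The proportion of mass kept by the branch `v` in passing from step `n` to step `n + 1`. -/
def moranWeight (p : ℕ → I) (v : ℕ → Bool) (n : ℕ) : ℝ := if v n then 1 - (p n : ℝ) else p n

/-- The mass of the Moran interval of step `n` on the branch `v`. -/
noncomputable def moranMass (p : ℕ → I) (v : ℕ → Bool) (n : ℕ) : ℝ :=
  ∏ i ∈ Finset.range n, moranWeight p v i

/-- Bound for the difference between the logarithm of a radius and that of the length of the Moran
interval chosen to represent the radius. -/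
noncomputable def levelError (A B : ℝ) : ℝ := Real.log (2 / (A * (1 - B)))

section Weights

variable {p : ℕ → I}

theorem moranWeight_pos (hp : ∀ n, (p n : ℝ) ∈ Set.Ioo 0 1) (v : ℕ → Bool) (n : ℕ) :
    0 < moranWeight p v n := by
  unfold moranWeight
  split_ifs
  exacts [sub_pos.2 (hp n).2, (hp n).1]

theorem moranMass_pos (hp : ∀ n, (p n : ℝ) ∈ Set.Ioo 0 1) (v : ℕ → Bool) (n : ℕ) :
    0 < moranMass p v n :=
  Finset.prod_pos fun i _ => moranWeight_pos hp v i

theorem moranMass_succ (v : ℕ → Bool) (n : ℕ) :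
    moranMass p v (n + 1) = moranWeight p v n * moranMass p v n := by
  rw [moranMass, Finset.prod_range_succ, mul_comm, moranMass]

theorem logPowDiv_moran_le_max (ψ : ℝ) (a b : ℕ → ℝ) (v : ℕ → Bool) (n : ℕ) :
    logPowDiv ψ (moranRatio a b v n) (moranWeight p v n)
      ≤ maxLogPowDiv ψ (a n) (b n) (p n) := by
  unfold moranRatio moranWeight
  split_ifs
  exacts [le_max_right _ _, le_max_left _ _]

theorem min_le_logPowDiv_moran (ψ : ℝ) (a b : ℕ → ℝ) (v : ℕ → Bool) (n : ℕ) :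
    minLogPowDiv ψ (a n) (b n) (p n)
      ≤ logPowDiv ψ (moranRatio a b v n) (moranWeight p v n) := by
  unfold moranRatio moranWeight
  split_ifs
  exacts [min_le_right _ _, min_le_left _ _]

theorem exists_branch_logPowDiv_eq_max (ψ : ℝ) (a b : ℕ → ℝ) (p : ℕ → I) :
    ∃ v : ℕ → Bool, ∀ n, logPowDiv ψ (moranRatio a b v n) (moranWeight p v n)
      = maxLogPowDiv ψ (a n) (b n) (p n) := by
  have hchoice : ∀ n, ∃ c : Bool,
      logPowDiv ψ (if c then b n else a n) (if c then 1 - (p n : ℝ) else p n)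
        = maxLogPowDiv ψ (a n) (b n) (p n) := fun n =>
    (max_choice _ _).elim (fun hmax => ⟨false, hmax.symm⟩) fun hmax => ⟨true, hmax.symm⟩
  exact Classical.skolem.1 hchoice

theorem exists_branch_logPowDiv_eq_min (ψ : ℝ) (a b : ℕ → ℝ) (p : ℕ → I) :
    ∃ v : ℕ → Bool, ∀ n, logPowDiv ψ (moranRatio a b v n) (moranWeight p v n)
      = minLogPowDiv ψ (a n) (b n) (p n) := by
  have hchoice : ∀ n, ∃ c : Bool,
      logPowDiv ψ (if c then b n else a n) (if c then 1 - (p n : ℝ) else p n)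
        = minLogPowDiv ψ (a n) (b n) (p n) := fun n =>
    (min_choice _ _).elim (fun hmin => ⟨false, hmin.symm⟩) fun hmin => ⟨true, hmin.symm⟩
  exact Classical.skolem.1 hchoice

end Weights

theorem measureReal_ball_pos {X : Type*} [PseudoMetricSpace X] [MeasurableSpace X]
    {μ : Measure X} [IsFiniteMeasure μ] {x : X} {r : ℝ} (hx : x ∈ μ.support) (hr : 0 < r) :
    0 < μ.real (Metric.ball x r) :=
  ENNReal.toReal_pos (Metric.nhds_basis_ball.mem_measureSupport.1 hx r hr).ne'
    (measure_ne_top μ _)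

theorem exists_moranPoint_dist_lt {a b : ℕ → ℝ} {p : ℕ → I} {x ε : ℝ}
    (hx : x ∈ (moranMeasure a b p).support) (hε : 0 < ε) :
    ∃ v, dist (moranPoint a b v) x < ε := by
  have hball := Metric.nhds_basis_ball.mem_measureSupport.1 hx ε hε
  rw [moranMeasure, Measure.map_apply measurable_moranPoint
    Metric.isOpen_ball.measurableSet] at hball
  exact nonempty_of_measure_ne_zero hball.ne'

namespace MoranBounds

variable {A B : ℝ} {a b : ℕ → ℝ} (h : MoranBounds A B a b)
include h

theorem le_left (n : ℕ) : A ≤ a n := (h.le_min n).trans (min_le_left _ _)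

theorem le_right (n : ℕ) : A ≤ b n := (h.le_min n).trans (min_le_right _ _)

theorem ratios (n : ℕ) : 0 < a n ∧ 0 < b n ∧ a n + b n < 1 :=
  ⟨h.pos.trans_le (h.le_left n), h.pos.trans_le (h.le_right n), (h.add_le n).trans_lt h.lt_one⟩

theorem le_ratio (v : ℕ → Bool) (n : ℕ) : A ≤ moranRatio a b v n := by
  unfold moranRatio
  split_ifs
  exacts [h.le_right n, h.le_left n]

theorem ratio_le (v : ℕ → Bool) (n : ℕ) : moranRatio a b v n ≤ B := by
  obtain ⟨ha, hb, -⟩ := h.ratios n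
  unfold moranRatio
  split_ifs <;> linarith [h.add_le n]

theorem ratio_pos (v : ℕ → Bool) (n : ℕ) : 0 < moranRatio a b v n :=
  h.pos.trans_le (h.le_ratio v n)

theorem B_pos : 0 < B := (h.ratio_pos (fun _ => true) 0).trans_le (h.ratio_le _ 0)

theorem A_lt_one : A < 1 :=
  ((h.le_ratio (fun _ => true) 0).trans (h.ratio_le _ 0)).trans_lt h.lt_one

theorem length_pos (v : ℕ → Bool) (n : ℕ) : 0 < moranLength a b v n :=
  moranLength_pos h.ratios v n

omit h in
theorem length_succ (v : ℕ → Bool) (n : ℕ) :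
    moranLength a b v (n + 1) = moranRatio a b v n * moranLength a b v n := rfl

theorem length_antitone (v : ℕ → Bool) : Antitone (moranLength a b v) :=
  antitone_nat_of_succ_le fun n =>
    mul_le_of_le_one_left (h.length_pos v n).le ((h.ratio_le v n).trans h.lt_one.le)

theorem length_le_pow (v : ℕ → Bool) (n : ℕ) : moranLength a b v n ≤ B ^ n := by
  induction n with
  | zero => simp [moranLength]
  | succ n ih =>
    rw [length_succ, pow_succ']
    exact mul_le_mul (h.ratio_le v n) ih (h.length_pos v n).le h.B_pos.le

theorem tendsto_length (v : ℕ → Bool) : Tendsto (moranLength a b v) atTop (𝓝 0) :=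
  squeeze_zero (fun n => (h.length_pos v n).le) (h.length_le_pow v)
    (tendsto_pow_atTop_nhds_zero_of_lt_one h.B_pos.le h.lt_one)

theorem log_length_succ (v : ℕ → Bool) (n : ℕ) :
    Real.log (moranLength a b v (n + 1))
      = Real.log (moranRatio a b v n) + Real.log (moranLength a b v n) := by
  rw [length_succ, Real.log_mul (h.ratio_pos v n).ne' (h.length_pos v n).ne']

theorem le_log_length_sub (v : ℕ → Bool) {n N : ℕ} (hnN : n ≤ N) :
    (N - n) * -Real.log B
      ≤ Real.log (moranLength a b v n) - Real.log (moranLength a b v N) := by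
  induction N, hnN using Nat.le_induction with
  | base => simp
  | succ N _ ih =>
    have hratio := Real.log_le_log (h.ratio_pos v N) (h.ratio_le v N)
    rw [h.log_length_succ]
    push_cast
    linarith

theorem log_length_sub_le (v : ℕ → Bool) {n N : ℕ} (hnN : n ≤ N) :
    Real.log (moranLength a b v n) - Real.log (moranLength a b v N)
      ≤ (N - n) * -Real.log A := by
  induction N, hnN using Nat.le_induction with
  | base => simp
  | succ N _ ih =>
    have hratio := Real.log_le_log h.pos (h.le_ratio v N)
    rw [h.log_length_succ]
    push_cast
    linarith

theorem mul_neg_log_le_neg_log_length (v : ℕ → Bool) (n : ℕ) :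
    n * -Real.log B ≤ -Real.log (moranLength a b v n) := by
  simpa [moranLength] using h.le_log_length_sub v n.zero_le

theorem neg_log_length_le (v : ℕ → Bool) (n : ℕ) :
    -Real.log (moranLength a b v n) ≤ n * -Real.log A := by
  simpa [moranLength] using h.log_length_sub_le v n.zero_le

theorem logPowDiv_moran_eq_sum {p : ℕ → I} (hp : ∀ n, (p n : ℝ) ∈ Set.Ioo 0 1) (ψ : ℝ)
    (v : ℕ → Bool) (n : ℕ) :
    logPowDiv ψ (moranLength a b v n) (moranMass p v n)
      = ∑ i ∈ Finset.range n, logPowDiv ψ (moranRatio a b v i) (moranWeight p v i) := by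
  induction n with
  | zero => simp [logPowDiv, moranLength, moranMass]
  | succ n ih =>
    rw [length_succ, moranMass_succ, logPowDiv_mul (h.ratio_pos v n).ne' (h.length_pos v n).ne'
      (moranWeight_pos hp v n).ne' (moranMass_pos hp v n).ne', Finset.sum_range_succ, ih, add_comm]

theorem logPowDiv_moran_sub {p : ℕ → I} (hp : ∀ n, (p n : ℝ) ∈ Set.Ioo 0 1) (ψ : ℝ)
    (v : ℕ → Bool) {n N : ℕ} (hnN : n ≤ N) :
    logPowDiv ψ (moranLength a b v N) (moranMass p v N)
        - logPowDiv ψ (moranLength a b v n) (moranMass p v n)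
      = ∑ i ∈ Finset.Ico n N, logPowDiv ψ (moranRatio a b v i) (moranWeight p v i) := by
  rw [h.logPowDiv_moran_eq_sum hp, h.logPowDiv_moran_eq_sum hp,
    Finset.sum_Ico_eq_sub _ hnN]

theorem le_sub_moranPoint {v w : ℕ → Bool} {k : ℕ} (hvw : ∀ i < k, v i = w i)
    (hv : v k = false) (hw : w k = true) :
    (1 - B) * moranLength a b v k ≤ moranPoint a b w - moranPoint a b v := by
  obtain ⟨hleft, hlength⟩ := moranLeft_congr (a := a) (b := b) hvw
  have hv_le := (moranPoint_mem h.ratios v (k + 1)).2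
  have hw_ge := (moranPoint_mem h.ratios w (k + 1)).1
  simp only [moranLeft, moranLength, hv, hw, if_true, Bool.false_eq_true, if_false, add_zero,
    ← hleft, ← hlength] at hv_le hw_ge
  have hsum := mul_le_mul_of_nonneg_right (h.add_le k) (h.length_pos v k).le
  linarith

theorem gap_le_dist {v w : ℕ → Bool} {k : ℕ} (hvw : ∀ i < k, v i = w i) (hk : v k ≠ w k) :
    (1 - B) * moranLength a b v k ≤ dist (moranPoint a b v) (moranPoint a b w) := by
  cases hv : v k
  · rw [dist_comm]
    exact (h.le_sub_moranPoint hvw hv (by simpa [hv] using hk.symm)).trans (le_abs_self _)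
  · rw [(moranLeft_congr (a := a) (b := b) hvw).2]
    exact (h.le_sub_moranPoint (fun i hi => (hvw i hi).symm) (by simpa [hv] using hk.symm)
      hv).trans (le_abs_self _)

variable {v : ℕ → Bool} {n : ℕ} {x r ρ : ℝ}

theorem measureReal_interval (p : ℕ → I) (v : ℕ → Bool) (n : ℕ) :
    (moranMeasure a b p).real (moranInterval a b v n) = moranMass p v n := by
  rw [Measure.real, moranMeasure_interval h.ratios, ENNReal.toReal_prod]
  refine Finset.prod_congr rfl fun i _ => ENNReal.toReal_ofReal ?_
  split_ifs
  exacts [sub_nonneg.2 (p i).2.2, (p i).2.1]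

theorem mass_le_ball (p : ℕ → I) (hr : moranLength a b v n < r) :
    moranMass p v n ≤ (moranMeasure a b p).real (Metric.ball (moranPoint a b v) r) := by
  rw [← h.measureReal_interval p v n]
  refine measureReal_mono (fun y hy => Metric.mem_ball.2 ?_) (measure_ne_top _ _)
  calc dist y (moranPoint a b v)
      ≤ moranLeft a b v n + moranLength a b v n - moranLeft a b v n :=
        Real.dist_le_of_mem_Icc hy (moranPoint_mem h.ratios v n)
    _ = moranLength a b v n := add_sub_cancel_left _ _
    _ < r := hr

theorem eq_of_dist_lt {w : ℕ → Bool} (hr : ∀ k < n, r ≤ (1 - B) * moranLength a b v k)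
    (hw : dist (moranPoint a b w) (moranPoint a b v) < r) : ∀ i < n, w i = v i := by
  intro i
  induction i using Nat.strong_induction_on with
  | _ i ih =>
    intro hi
    by_contra hne
    have hgap := h.gap_le_dist (fun j hj => (ih j hj (hj.trans hi)).symm) (Ne.symm hne)
    rw [dist_comm] at hw
    exact (hw.trans_le (hr i hi)).not_ge hgap

theorem ball_le_mass (p : ℕ → I) (hr : ∀ k < n, r ≤ (1 - B) * moranLength a b v k) :
    (moranMeasure a b p).real (Metric.ball (moranPoint a b v) r) ≤ moranMass p v n := by
  rw [← h.measureReal_interval p v n, moranMeasure,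
    map_measureReal_apply measurable_moranPoint Metric.isOpen_ball.measurableSet,
    map_measureReal_apply measurable_moranPoint
      (show MeasurableSet (moranInterval a b v n) from measurableSet_Icc)]
  refine measureReal_mono (fun w hw => ?_) (measure_ne_top _ _)
  rw [moranPoint_preimage h.ratios]
  exact fun i hi => h.eq_of_dist_lt hr hw i (by simpa using hi)

theorem moranPoint_mem_support {p : ℕ → I} (hp : ∀ n, (p n : ℝ) ∈ Set.Ioo 0 1)
    (v : ℕ → Bool) : moranPoint a b v ∈ (moranMeasure a b p).support := by
  rw [Metric.nhds_basis_ball.mem_measureSupport]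
  intro r hr
  obtain ⟨n, hn⟩ := ((h.tendsto_length v).eventually_lt_const hr).exists
  exact (ENNReal.toReal_pos_iff.1 ((moranMass_pos hp v n).trans_le (h.mass_le_ball p hn))).1

theorem exists_first_length_lt (v : ℕ → Bool) (hr : 0 < r) (hr_one : r ≤ 1) :
    ∃ n, moranLength a b v n < r ∧ A * r ≤ moranLength a b v n ∧
      ∀ k < n, r ≤ moranLength a b v k := by
  classical
  have hex : ∃ n, moranLength a b v n < r :=
    ((h.tendsto_length v).eventually_lt_const hr).exists
  have hlt : moranLength a b v (Nat.find hex) < r := Nat.find_spec hex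
  have hbefore : ∀ k < Nat.find hex, r ≤ moranLength a b v k :=
    fun k hk => not_lt.1 (Nat.find_min hex hk)
  refine ⟨Nat.find hex, hlt, ?_, hbefore⟩
  rcases hm : Nat.find hex with _ | m
  · rw [hm] at hlt
    exact absurd hr_one hlt.not_ge
  · rw [length_succ]
    exact mul_le_mul (h.le_ratio v m) (hbefore m (by omega)) hr.le (h.ratio_pos v m).le

/-! ### Levels and radii -/

theorem abs_log_length_sub_le (hρ : 0 < ρ)
    (hle : moranLength a b v n ≤ 2 / (A * (1 - B)) * ρ)
    (hge : A * ((1 - B) / 2) * ρ ≤ moranLength a b v n) :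
    |Real.log (moranLength a b v n) - Real.log ρ| ≤ levelError A B := by
  have hA := h.pos
  have hB : 0 < 1 - B := sub_pos.2 h.lt_one
  refine abs_log_sub_log_le_log (h.length_pos v n) hρ hle ?_
  rw [div_mul_eq_mul_div, le_div_iff₀ (by positivity)]
  linarith

theorem exists_level_mass_le_ball (p : ℕ → I) (hρ : 0 < ρ) (hρ_one : ρ ≤ 1)
    (hx : dist (moranPoint a b v) x < ρ / 2) :
    ∃ n, |Real.log (moranLength a b v n) - Real.log ρ| ≤ levelError A B ∧
      moranMass p v n ≤ (moranMeasure a b p).real (Metric.ball x ρ) := by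
  have hA := h.pos
  have hB : 0 < 1 - B := sub_pos.2 h.lt_one
  obtain ⟨n, hlt, hge, -⟩ := h.exists_first_length_lt v (half_pos hρ) (by linarith)
  refine ⟨n, h.abs_log_length_sub_le hρ ?_ ?_, (h.mass_le_ball p hlt).trans <|
    measureReal_mono (Metric.ball_subset_ball' (by linarith)) (measure_ne_top _ _)⟩
  · have hconst : 1 / 2 ≤ 2 / (A * (1 - B)) := by
      rw [div_le_div_iff₀ two_pos (by positivity)]
      nlinarith [h.A_lt_one, h.B_pos]
    calc moranLength a b v n ≤ 1 / 2 * ρ := by linarith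
      _ ≤ 2 / (A * (1 - B)) * ρ := by gcongr
  · calc A * ((1 - B) / 2) * ρ ≤ A * (1 / 2) * ρ := by
          gcongr
          linarith [h.B_pos]
      _ = A * (ρ / 2) := by ring
      _ ≤ moranLength a b v n := hge

theorem exists_level_ball_le_mass (p : ℕ → I) (hρ : 0 < ρ) (hρ_le : ρ ≤ (1 - B) / 2)
    (hx : dist (moranPoint a b v) x < ρ) :
    ∃ n, |Real.log (moranLength a b v n) - Real.log ρ| ≤ levelError A B ∧
      (moranMeasure a b p).real (Metric.ball x ρ) ≤ moranMass p v n := by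
  have hA := h.pos
  have hB : 0 < 1 - B := sub_pos.2 h.lt_one
  obtain ⟨n, hlt, hge, hbefore⟩ := h.exists_first_length_lt v
    (show 0 < 2 * ρ / (1 - B) by positivity) (by rw [div_le_one hB]; linarith)
  refine ⟨n, h.abs_log_length_sub_le hρ ?_ ?_, (measureReal_mono (Metric.ball_subset_ball'
    (ε₂ := 2 * ρ) ?_) (measure_ne_top _ _)).trans (h.ball_le_mass p fun k hk => ?_)⟩
  · calc moranLength a b v n ≤ 2 / (1 - B) * ρ := by rw [div_mul_eq_mul_div]; exact hlt.le
      _ ≤ 2 / (A * (1 - B)) * ρ := by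
        gcongr
        exact mul_le_of_le_one_left hB.le h.A_lt_one.le
  · calc A * ((1 - B) / 2) * ρ ≤ A * (2 / (1 - B)) * ρ := by
          gcongr <;> linarith [h.B_pos]
      _ = A * (2 * ρ / (1 - B)) := by ring
      _ ≤ moranLength a b v n := hge
  · rw [dist_comm]
    linarith
  · have hk_length := hbefore k hk
    rwa [div_le_iff₀ hB, mul_comm (moranLength a b v k)] at hk_length

/-- In logarithmic scale, with `u = -log R`, the level of `R` is of order `u`, while the level of
`r` is deeper by at least a multiple of `s * u`. -/
theorem level_gap_of_lt_rpow {s K R : ℝ} {N : ℕ} (hs : 0 < s) (hr : 0 < r) (hR : 0 < R)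
    (hrR : r < R ^ (1 + s)) (hKR : K ≤ -Real.log R) (hKsR : 4 * K ≤ s * -Real.log R)
    (hn : |Real.log (moranLength a b v n) - Real.log R| ≤ K)
    (hN : |Real.log (moranLength a b v N) - Real.log r| ≤ K) :
    n ≤ N ∧ s * -Real.log B / (4 * -Real.log A) * n ≤ (N : ℝ) - n := by
  have hn_lower := (abs_le.1 hn).1
  have hN_upper := (abs_le.1 hN).2
  have hK : 0 ≤ K := (abs_nonneg _).trans hn
  have hlog_r : Real.log r < (1 + s) * Real.log R := by
    rw [← Real.log_rpow hR]
    exact Real.log_lt_log hr hrR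
  have hdepth : s * -Real.log R / 2
      < Real.log (moranLength a b v n) - Real.log (moranLength a b v N) := by linarith
  have hlog_R : 0 ≤ -Real.log R := hK.trans hKR
  have hlog_lt : Real.log (moranLength a b v N) < Real.log (moranLength a b v n) :=
    sub_pos.1 (hdepth.trans_le' (by positivity))
  have hnN : n ≤ N := by
    by_contra! hNn
    exact hlog_lt.not_ge (Real.log_le_log (h.length_pos v n) (h.length_antitone v hNn.le))
  have hlevel : n * -Real.log B ≤ 2 * -Real.log R := by
    linarith [h.mul_neg_log_le_neg_log_length v n]
  have hα : 0 < -Real.log A := neg_pos.2 (Real.log_neg h.pos h.A_lt_one)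
  refine ⟨hnN, ?_⟩
  rw [div_mul_eq_mul_div, div_le_iff₀ (by positivity)]
  linarith [mul_le_mul_of_nonneg_left hlevel hs.le, h.log_length_sub_le v hnN]

theorem exists_level_gap {s : ℝ} (hs : 0 < s) (K : ℝ) :
    ∃ c : ℝ, 0 < c ∧ ∀ n₀ : ℕ, ∃ C : ℝ, 0 < C ∧
      ∀ (r R : ℝ) (v : ℕ → Bool) (n N : ℕ), 0 < r → 0 < R → r < R ^ (1 + s) → R ≤ C →
        |Real.log (moranLength a b v n) - Real.log R| ≤ K →
        |Real.log (moranLength a b v N) - Real.log r| ≤ K →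
          n₀ ≤ n ∧ n ≤ N ∧ c * n ≤ (N : ℝ) - n := by
  have hα : 0 < -Real.log A := neg_pos.2 (Real.log_neg h.pos h.A_lt_one)
  have hβ : 0 < -Real.log B := neg_pos.2 (Real.log_neg h.B_pos h.lt_one)
  refine ⟨s * -Real.log B / (4 * -Real.log A), by positivity, fun n₀ => ?_⟩
  refine ⟨Real.exp (-max (4 * K / s) (max K (n₀ * -Real.log A + K))), Real.exp_pos _,
    fun r R v n N hr hR hrR hRC hn hN => ?_⟩
  have hsmall := le_neg_of_le_neg ((Real.log_le_iff_le_exp hR).2 hRC)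
  rw [max_le_iff, max_le_iff, div_le_iff₀' hs] at hsmall
  obtain ⟨hKsR, hKR, hn₀R⟩ := hsmall
  have hlevel : n₀ * -Real.log A ≤ n * -Real.log A := by
    linarith [h.neg_log_length_le v n, (abs_le.1 hn).2]
  exact ⟨Nat.cast_le.1 (le_of_mul_le_mul_right hlevel hα),
    h.level_gap_of_lt_rpow hs hr hR hrR hKR hKsR hn hN⟩

theorem exists_eventually_radii {s : ℝ} (hs : 0 < s) :
    ∃ K : ℕ, 0 < K ∧ ∀ (v : ℕ → Bool) (k₁ k₂ C : ℝ), 0 < k₁ → 0 < k₂ → 0 < C →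
      ∀ᶠ n : ℕ in atTop,
        k₂ * moranLength a b v (n + K * n) < (k₁ * moranLength a b v n) ^ (1 + s) ∧
        (k₁ * moranLength a b v n) ^ (1 + s) ≤ k₁ * moranLength a b v n ∧
        k₁ * moranLength a b v n ≤ C := by
  have hα : 0 < -Real.log A := neg_pos.2 (Real.log_neg h.pos h.A_lt_one)
  have hβ : 0 < -Real.log B := neg_pos.2 (Real.log_neg h.B_pos h.lt_one)
  obtain ⟨K, hK⟩ := exists_nat_gt ((1 + s * -Real.log A) / -Real.log B)
  refine ⟨K, Nat.cast_pos.1 ((div_pos (by positivity) hβ).trans hK),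
    fun v k₁ k₂ C hk₁ hk₂ hC => ?_⟩
  rw [div_lt_iff₀ hβ] at hK
  have hlength : Tendsto (fun n => k₁ * moranLength a b v n) atTop (𝓝 0) := by
    simpa using (h.tendsto_length v).const_mul k₁
  filter_upwards [hlength.eventually_le_const hC, hlength.eventually_le_const one_pos,
    tendsto_natCast_atTop_atTop.eventually_gt_atTop
      (Real.log k₂ - (1 + s) * Real.log k₁)] with n hn_C hn_one hn_large
  have hLn := h.length_pos v n
  have hLN := h.length_pos v (n + K * n)
  refine ⟨?_, Real.rpow_le_self_of_le_one (by positivity) hn_one (by linarith), hn_C⟩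
  rw [← Real.log_lt_log_iff (by positivity) (by positivity), Real.log_rpow (by positivity),
    Real.log_mul hk₁.ne' hLn.ne', Real.log_mul hk₂.ne' hLN.ne']
  have hshrink := h.le_log_length_sub v (Nat.le_add_right n (K * n))
  push_cast at hshrink
  have hmargin := mul_le_mul_of_nonneg_left hK.le (Nat.cast_nonneg (α := ℝ) n)
  have hs_length := mul_le_mul_of_nonneg_left (h.neg_log_length_le v n) hs.le
  linarith

theorem moranMass_div_le_ball_div {p : ℕ → I} (hp : ∀ n, (p n : ℝ) ∈ Set.Ioo 0 1)
    (v : ℕ → Bool) (n N : ℕ) :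
    moranMass p v n / moranMass p v N
      ≤ (moranMeasure a b p).real (Metric.ball (moranPoint a b v) (2 * moranLength a b v n))
        / (moranMeasure a b p).real
          (Metric.ball (moranPoint a b v) ((1 - B) * moranLength a b v N)) := by
  have hB : 0 < 1 - B := sub_pos.2 h.lt_one
  have hball := measureReal_ball_pos (h.moranPoint_mem_support hp v)
    (mul_pos hB (h.length_pos v N))
  exact div_le_div₀ measureReal_nonneg
    (h.mass_le_ball p (lt_mul_of_one_lt_left (h.length_pos v n) one_lt_two)) hball
    (h.ball_le_mass p fun _ hk => mul_le_mul_of_nonneg_left (h.length_antitone v hk.le) hB.le)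

theorem ball_div_le_moranMass_div {p : ℕ → I} (hp : ∀ n, (p n : ℝ) ∈ Set.Ioo 0 1)
    (v : ℕ → Bool) (n N : ℕ) :
    (moranMeasure a b p).real (Metric.ball (moranPoint a b v) ((1 - B) * moranLength a b v n))
        / (moranMeasure a b p).real (Metric.ball (moranPoint a b v) (2 * moranLength a b v N))
      ≤ moranMass p v n / moranMass p v N :=
  div_le_div₀ (moranMass_pos hp v n).le
    (h.ball_le_mass p fun _ hk =>
      mul_le_mul_of_nonneg_left (h.length_antitone v hk.le) (sub_pos.2 h.lt_one).le)
    (moranMass_pos hp v N)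
    (h.mass_le_ball p (lt_mul_of_one_lt_left (h.length_pos v N) one_lt_two))

theorem exists_levels_ball_div_le {p : ℕ → I} (hp : ∀ n, (p n : ℝ) ∈ Set.Ioo 0 1)
    {R : ℝ} (hx : x ∈ (moranMeasure a b p).support) (hr : 0 < r) (hrR : r < R)
    (hR : R ≤ (1 - B) / 2) :
    ∃ v n N, |Real.log (moranLength a b v n) - Real.log R| ≤ levelError A B ∧
      |Real.log (moranLength a b v N) - Real.log r| ≤ levelError A B ∧
      (moranMeasure a b p).real (Metric.ball x R) / (moranMeasure a b p).real (Metric.ball x r)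
        ≤ moranMass p v n / moranMass p v N := by
  have hB := h.B_pos
  obtain ⟨v, hv⟩ := exists_moranPoint_dist_lt hx (half_pos hr)
  obtain ⟨n, hn, hn_mass⟩ := h.exists_level_ball_le_mass p (hr.trans hrR) hR
    (hv.trans (by linarith))
  obtain ⟨N, hN, hN_mass⟩ := h.exists_level_mass_le_ball p hr (by linarith) hv
  exact ⟨v, n, N, hn, hN,
    div_le_div₀ (moranMass_pos hp v n).le hn_mass (moranMass_pos hp v N) hN_mass⟩

theorem exists_levels_le_ball_div {p : ℕ → I}
    {R : ℝ} (hx : x ∈ (moranMeasure a b p).support) (hr : 0 < r) (hrR : r < R)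
    (hR : R ≤ (1 - B) / 2) :
    ∃ v n N, |Real.log (moranLength a b v n) - Real.log R| ≤ levelError A B ∧
      |Real.log (moranLength a b v N) - Real.log r| ≤ levelError A B ∧
      moranMass p v n / moranMass p v N
        ≤ (moranMeasure a b p).real (Metric.ball x R)
          / (moranMeasure a b p).real (Metric.ball x r) := by
  have hB := h.B_pos
  obtain ⟨v, hv⟩ := exists_moranPoint_dist_lt hx (half_pos hr)
  obtain ⟨n, hn, hn_mass⟩ := h.exists_level_mass_le_ball p (hr.trans hrR) (by linarith)
    (hv.trans (by linarith))
  obtain ⟨N, hN, hN_mass⟩ := h.exists_level_ball_le_mass p hr (by linarith)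
    (hv.trans (by linarith))
  exact ⟨v, n, N, hn, hN,
    div_le_div₀ measureReal_nonneg hn_mass (measureReal_ball_pos hx hr) hN_mass⟩

/-! ### Admissible exponents -/

variable {p : ℕ → I} {θ ψ d m : ℝ}

theorem upperPhiBound (hp : ∀ n, (p n : ℝ) ∈ Set.Ioo 0 1) (hθ : 0 < θ) (hθ_one : θ < 1)
    (hS : Tendsto (fun n : ℕ => (∑ i ∈ Finset.range n, maxLogPowDiv ψ (a i) (b i) (p i)) / n)
      atTop (𝓝 m)) (hm : m < 0) :
    UpperPhiBound (phiTheta θ) (moranMeasure a b p) ψ := by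
  have hB : 0 < (1 - B) / 2 := half_pos (sub_pos.2 h.lt_one)
  obtain ⟨c, hc, hgap⟩ := h.exists_level_gap (one_div_sub_one_pos hθ hθ_one) (levelError A B)
  obtain ⟨n₀, hn₀⟩ :=
    eventually_atTop.1 (eventually_forall_le_of_tendsto_div_neg hS hm hc)
  obtain ⟨C, hC, hlevels⟩ := hgap n₀
  refine ⟨min C ((1 - B) / 2), lt_min hC hB, Real.exp (2 * levelError A B * |ψ|),
    Real.exp_pos _, fun r R hr hrR hRR hRC x hx => ?_⟩
  obtain ⟨v, n, N, hn, hN, hratio⟩ := h.exists_levels_ball_div_le hp hx hr (hrR.trans_le hRR)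
    (hRC.trans (min_le_right _ _))
  have hR : 0 < R := hr.trans (hrR.trans_le hRR)
  obtain ⟨hn₀n, hnN, hcN⟩ := hlevels r R v n N hr hR hrR (hRC.trans (min_le_left _ _)) hn hN
  have hdecrease : logPowDiv ψ (moranLength a b v N) (moranMass p v N)
      - logPowDiv ψ (moranLength a b v n) (moranMass p v n) ≤ 0 := by
    rw [h.logPowDiv_moran_sub hp ψ v hnN]
    refine (Finset.sum_le_sum fun i _ => logPowDiv_moran_le_max ψ a b v i).trans ?_
    rw [Finset.sum_Ico_eq_sub _ hnN]
    exact sub_nonpos.2 (hn₀ n hn₀n N hnN hcN)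
  have herror := (abs_le.1 (abs_mul_sub_sub_le (ψ := ψ) hn hN)).2
  refine hratio.trans ((div_le_mul_div_rpow_iff (moranMass_pos hp v n) (moranMass_pos hp v N)
    hR hr (Real.exp_pos _)).2 ?_)
  rw [Real.log_exp]
  unfold logPowDiv at hdecrease
  linarith

theorem lowerPhiBound (hp : ∀ n, (p n : ℝ) ∈ Set.Ioo 0 1) (hθ : 0 < θ) (hθ_one : θ < 1)
    (hS : Tendsto (fun n : ℕ => (∑ i ∈ Finset.range n, minLogPowDiv ψ (a i) (b i) (p i)) / n)
      atTop (𝓝 m)) (hm : 0 < m) :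
    LowerPhiBound (phiTheta θ) (moranMeasure a b p) ψ := by
  have hB : 0 < (1 - B) / 2 := half_pos (sub_pos.2 h.lt_one)
  obtain ⟨c, hc, hgap⟩ := h.exists_level_gap (one_div_sub_one_pos hθ hθ_one) (levelError A B)
  obtain ⟨n₀, hn₀⟩ :=
    eventually_atTop.1 (eventually_forall_le_of_tendsto_div_pos hS hm hc)
  obtain ⟨C, hC, hlevels⟩ := hgap n₀
  refine ⟨min C ((1 - B) / 2), lt_min hC hB, Real.exp (-(2 * levelError A B * |ψ|)),
    Real.exp_pos _, fun r R hr hrR hRR hRC x hx => ?_⟩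
  obtain ⟨v, n, N, hn, hN, hratio⟩ := h.exists_levels_le_ball_div hx hr (hrR.trans_le hRR)
    (hRC.trans (min_le_right _ _))
  have hR : 0 < R := hr.trans (hrR.trans_le hRR)
  obtain ⟨hn₀n, hnN, hcN⟩ := hlevels r R v n N hr hR hrR (hRC.trans (min_le_left _ _)) hn hN
  have hincrease : 0 ≤ logPowDiv ψ (moranLength a b v N) (moranMass p v N)
      - logPowDiv ψ (moranLength a b v n) (moranMass p v n) := by
    rw [h.logPowDiv_moran_sub hp ψ v hnN]
    refine le_trans ?_ (Finset.sum_le_sum fun i _ => min_le_logPowDiv_moran ψ a b v i)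
    rw [Finset.sum_Ico_eq_sub _ hnN]
    exact sub_nonneg.2 (hn₀ n hn₀n N hnN hcN)
  have herror := (abs_le.1 (abs_mul_sub_sub_le (ψ := ψ) hn hN)).1
  refine le_trans ((mul_div_rpow_le_div_iff (moranMass_pos hp v n) (moranMass_pos hp v N)
    hR hr (Real.exp_pos _)).2 ?_) hratio
  rw [Real.log_exp]
  unfold logPowDiv at hincrease
  linarith

theorem le_of_upperPhiBound (hp : ∀ n, (p n : ℝ) ∈ Set.Ioo 0 1) (hθ : 0 < θ) (hθ_one : θ < 1)
    (hS : Tendsto (fun n : ℕ => logPowDiv ψ (moranLength a b v n) (moranMass p v n) / n)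
      atTop (𝓝 m)) (hm : 0 ≤ m)
    (hd : UpperPhiBound (phiTheta θ) (moranMeasure a b p) d) : ψ ≤ d := by
  have hB : 0 < 1 - B := sub_pos.2 h.lt_one
  obtain ⟨C₁, hC₁, C₂, hC₂, hball⟩ := hd
  obtain ⟨K, hK, hradii⟩ := h.exists_eventually_radii (one_div_sub_one_pos hθ hθ_one)
  refine le_of_eventually_sub_add_mul_le (D := fun n => -Real.log (moranLength a b v n))
    (c := Real.log C₂ + d * (Real.log 2 - Real.log (1 - B))) hS hm
    (neg_pos.2 (Real.log_neg h.B_pos h.lt_one)) hK (fun n => ?_) ?_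
  · have hlength := h.le_log_length_sub v (Nat.le_add_right n (K * n))
    push_cast at hlength
    linarith
  filter_upwards [hradii v 2 (1 - B) C₁ two_pos hB hC₁] with n ⟨hrR, hRR, hRC⟩
  have hLn := h.length_pos v n
  have hLN := h.length_pos v (n + K * n)
  have hmass := (div_le_mul_div_rpow_iff (moranMass_pos hp v n) (moranMass_pos hp v _)
    (mul_pos two_pos hLn) (mul_pos hB hLN) hC₂).1 <|
    (h.moranMass_div_le_ball_div hp v n _).trans <|
      hball _ _ (mul_pos hB hLN) hrR hRR hRC _ (h.moranPoint_mem_support hp v)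
  rw [Real.log_mul two_ne_zero hLn.ne', Real.log_mul hB.ne' hLN.ne'] at hmass
  unfold logPowDiv
  linarith

theorem le_of_lowerPhiBound (hp : ∀ n, (p n : ℝ) ∈ Set.Ioo 0 1) (hθ : 0 < θ) (hθ_one : θ < 1)
    (hS : Tendsto (fun n : ℕ => logPowDiv ψ (moranLength a b v n) (moranMass p v n) / n)
      atTop (𝓝 m)) (hm : m ≤ 0)
    (hd : LowerPhiBound (phiTheta θ) (moranMeasure a b p) d) : d ≤ ψ := by
  have hB : 0 < 1 - B := sub_pos.2 h.lt_one
  obtain ⟨C₁, hC₁, C₂, hC₂, hball⟩ := hd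
  obtain ⟨K, hK, hradii⟩ := h.exists_eventually_radii (one_div_sub_one_pos hθ hθ_one)
  have hS_neg : Tendsto
      (fun n : ℕ => -logPowDiv ψ (moranLength a b v n) (moranMass p v n) / n) atTop (𝓝 (-m)) := by
    simpa only [neg_div] using hS.neg
  refine neg_le_neg_iff.1 (le_of_eventually_sub_add_mul_le
    (D := fun n => -Real.log (moranLength a b v n))
    (c := -Real.log C₂ - d * (Real.log (1 - B) - Real.log 2)) hS_neg (neg_nonneg.2 hm)
    (neg_pos.2 (Real.log_neg h.B_pos h.lt_one)) hK (fun n => ?_) ?_)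
  · have hlength := h.le_log_length_sub v (Nat.le_add_right n (K * n))
    push_cast at hlength
    linarith
  filter_upwards [hradii v (1 - B) 2 C₁ hB two_pos hC₁] with n ⟨hrR, hRR, hRC⟩
  have hLn := h.length_pos v n
  have hLN := h.length_pos v (n + K * n)
  have hmass := (mul_div_rpow_le_div_iff (moranMass_pos hp v n) (moranMass_pos hp v _)
    (mul_pos hB hLn) (mul_pos two_pos hLN) hC₂).1 <|
    (hball _ _ (mul_pos two_pos hLN) hrR hRR hRC _ (h.moranPoint_mem_support hp v)).trans
      (h.ball_div_le_moranMass_div hp v n _)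
  rw [Real.log_mul two_ne_zero hLN.ne', Real.log_mul hB.ne' hLn.ne'] at hmass
  unfold logPowDiv
  linarith

end MoranBounds

/-! ### Quasi-Assouad dimensions -/

section QuasiAssouad

variable {X : Type*} [PseudoMetricSpace X] [MeasurableSpace X] {μ : Measure X} {ψ : ℝ}

theorem quasiAssouadDim_le_of_forall_upperPhiBound
    (hψ : ∀ θ, 0 < θ → θ < 1 → UpperPhiBound (phiTheta θ) μ ψ) : quasiAssouadDim μ ≤ ψ := by
  refine le_of_tendsto (tendsto_quasiAssouadDim μ) ?_
  filter_upwards [Ioo_mem_nhdsLT (zero_lt_one (α := ℝ))] with θ ⟨hθ, hθ_one⟩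
  exact sInf_le ⟨ψ, hψ θ hθ hθ_one, rfl⟩

theorem le_quasiAssouadDim_of_forall_le
    (hψ : ∀ θ, 0 < θ → θ < 1 → ∀ d, UpperPhiBound (phiTheta θ) μ d → ψ ≤ d) :
    ψ ≤ quasiAssouadDim μ := by
  refine ge_of_tendsto (tendsto_quasiAssouadDim μ) ?_
  filter_upwards [Ioo_mem_nhdsLT (zero_lt_one (α := ℝ))] with θ ⟨hθ, hθ_one⟩
  exact le_sInf <| Set.forall_mem_image.2 fun d hd =>
    EReal.coe_le_coe_iff.2 (hψ θ hθ hθ_one d hd)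

theorem le_quasiLowerAssouadDim_of_forall_lowerPhiBound
    (hψ : ∀ θ, 0 < θ → θ < 1 → LowerPhiBound (phiTheta θ) μ ψ) :
    ψ ≤ quasiLowerAssouadDim μ := by
  refine ge_of_tendsto (tendsto_quasiLowerAssouadDim μ) ?_
  filter_upwards [Ioo_mem_nhdsLT (zero_lt_one (α := ℝ))] with θ ⟨hθ, hθ_one⟩
  exact le_sSup ⟨ψ, hψ θ hθ hθ_one, rfl⟩

theorem quasiLowerAssouadDim_le_of_forall_le
    (hψ : ∀ θ, 0 < θ → θ < 1 → ∀ d, LowerPhiBound (phiTheta θ) μ d → d ≤ ψ) :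
    quasiLowerAssouadDim μ ≤ ψ := by
  refine le_of_tendsto (tendsto_quasiLowerAssouadDim μ) ?_
  filter_upwards [Ioo_mem_nhdsLT (zero_lt_one (α := ℝ))] with θ ⟨hθ, hθ_one⟩
  exact sSup_le <| Set.forall_mem_image.2 fun d hd =>
    EReal.coe_le_coe_iff.2 (hψ θ hθ hθ_one d hd)

end QuasiAssouad

namespace MoranBounds

variable {A B ψ m : ℝ} {a b : ℕ → ℝ} (h : MoranBounds A B a b) {p : ℕ → I}
  (hp : ∀ n, (p n : ℝ) ∈ Set.Ioo 0 1)
include h hp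

theorem quasiAssouadDim_le
    (hS : Tendsto (fun n : ℕ => (∑ i ∈ Finset.range n, maxLogPowDiv ψ (a i) (b i) (p i)) / n)
      atTop (𝓝 m)) (hm : m < 0) : quasiAssouadDim (moranMeasure a b p) ≤ ψ :=
  quasiAssouadDim_le_of_forall_upperPhiBound fun _ hθ hθ_one =>
    h.upperPhiBound hp hθ hθ_one hS hm

theorem le_quasiAssouadDim
    (hS : Tendsto (fun n : ℕ => (∑ i ∈ Finset.range n, maxLogPowDiv ψ (a i) (b i) (p i)) / n)
      atTop (𝓝 m)) (hm : 0 ≤ m) : ψ ≤ quasiAssouadDim (moranMeasure a b p) := by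
  obtain ⟨v, hv⟩ := exists_branch_logPowDiv_eq_max ψ a b p
  refine le_quasiAssouadDim_of_forall_le fun θ hθ hθ_one d hd =>
    h.le_of_upperPhiBound (v := v) hp hθ hθ_one ?_ hm hd
  simpa only [h.logPowDiv_moran_eq_sum hp, hv] using hS

theorem le_quasiLowerAssouadDim
    (hS : Tendsto (fun n : ℕ => (∑ i ∈ Finset.range n, minLogPowDiv ψ (a i) (b i) (p i)) / n)
      atTop (𝓝 m)) (hm : 0 < m) : ψ ≤ quasiLowerAssouadDim (moranMeasure a b p) :=
  le_quasiLowerAssouadDim_of_forall_lowerPhiBound fun _ hθ hθ_one =>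
    h.lowerPhiBound hp hθ hθ_one hS hm

theorem quasiLowerAssouadDim_le
    (hS : Tendsto (fun n : ℕ => (∑ i ∈ Finset.range n, minLogPowDiv ψ (a i) (b i) (p i)) / n)
      atTop (𝓝 m)) (hm : m ≤ 0) : quasiLowerAssouadDim (moranMeasure a b p) ≤ ψ := by
  obtain ⟨v, hv⟩ := exists_branch_logPowDiv_eq_min ψ a b p
  refine quasiLowerAssouadDim_le_of_forall_le fun θ hθ hθ_one d hd =>
    h.le_of_lowerPhiBound (v := v) hp hθ hθ_one ?_ hm hd
  simpa only [h.logPowDiv_moran_eq_sum hp, hv] using hS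

end MoranBounds

/-! ### Comparison with the thresholds -/

section Threshold

variable {ψ a b p : ℝ} (ha : 0 < a) (hb : 0 < b) (hp : p ∈ Set.Ioo 0 1)
include ha hb hp

theorem le_threshold_iff :
    p ≤ a ^ ψ / (a ^ ψ + b ^ ψ) ↔ logPowDiv ψ b (1 - p) ≤ logPowDiv ψ a p := by
  obtain ⟨hp_pos, hp_one⟩ := hp
  have hq : 0 < 1 - p := sub_pos.2 hp_one
  calc p ≤ a ^ ψ / (a ^ ψ + b ^ ψ)
      ↔ p * b ^ ψ ≤ (1 - p) * a ^ ψ := by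
        rw [le_div_iff₀ (by positivity), mul_add, sub_mul, one_mul, le_sub_iff_add_le']
    _ ↔ Real.log p + ψ * Real.log b ≤ Real.log (1 - p) + ψ * Real.log a := by
        rw [← Real.log_le_log_iff (by positivity) (by positivity),
          Real.log_mul hp_pos.ne' (by positivity), Real.log_mul hq.ne' (by positivity),
          Real.log_rpow hb, Real.log_rpow ha]
    _ ↔ logPowDiv ψ b (1 - p) ≤ logPowDiv ψ a p := by
        unfold logPowDiv
        rw [sub_le_sub_iff, add_comm, add_comm (Real.log (1 - p))]

theorem threshold_le_iff :
    a ^ ψ / (a ^ ψ + b ^ ψ) ≤ p ↔ logPowDiv ψ a p ≤ logPowDiv ψ b (1 - p) := by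
  have hcompl : a ^ ψ / (a ^ ψ + b ^ ψ) = 1 - b ^ ψ / (b ^ ψ + a ^ ψ) := by
    field_simp
    ring
  rw [hcompl, sub_le_comm,
    le_threshold_iff hb ha ⟨sub_pos.2 hp.2, sub_lt_self 1 hp.1⟩, sub_sub_cancel]

theorem mul_thresholdZ_sub_thresholdY :
    ψ * thresholdZ ψ a b p - thresholdY ψ a b p = maxLogPowDiv ψ a b p := by
  unfold thresholdZ thresholdY
  split_ifs with hle
  · exact (max_eq_left ((le_threshold_iff ha hb hp).1 hle)).symm
  · rw [le_threshold_iff ha hb hp, not_le] at hle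
    exact (max_eq_right hle.le).symm

theorem mul_thresholdZ'_sub_thresholdY' :
    ψ * thresholdZ' ψ a b p - thresholdY' ψ a b p = minLogPowDiv ψ a b p := by
  unfold thresholdZ' thresholdY'
  split_ifs with hle
  · exact (min_eq_left ((threshold_le_iff ha hb hp).1 hle)).symm
  · rw [threshold_le_iff ha hb hp, not_le] at hle
    exact (min_eq_right hle.le).symm

end Threshold

theorem measurableSet_le_threshold (ψ : ℝ) :
    MeasurableSet {x : (ℝ × ℝ) × I | (x.2 : ℝ) ≤ x.1.1 ^ ψ / (x.1.1 ^ ψ + x.1.2 ^ ψ)} :=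
  measurableSet_le (by fun_prop) (by fun_prop)

theorem measurableSet_threshold_le (ψ : ℝ) :
    MeasurableSet {x : (ℝ × ℝ) × I | x.1.1 ^ ψ / (x.1.1 ^ ψ + x.1.2 ^ ψ) ≤ (x.2 : ℝ)} :=
  measurableSet_le (by fun_prop) (by fun_prop)

theorem measurable_thresholdY (ψ : ℝ) :
    Measurable fun x : (ℝ × ℝ) × I => thresholdY ψ x.1.1 x.1.2 x.2 :=
  Measurable.ite (measurableSet_le_threshold ψ) (by fun_prop) (by fun_prop)

theorem measurable_thresholdZ (ψ : ℝ) :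
    Measurable fun x : (ℝ × ℝ) × I => thresholdZ ψ x.1.1 x.1.2 x.2 :=
  Measurable.ite (measurableSet_le_threshold ψ) (by fun_prop) (by fun_prop)

theorem measurable_thresholdY' (ψ : ℝ) :
    Measurable fun x : (ℝ × ℝ) × I => thresholdY' ψ x.1.1 x.1.2 x.2 :=
  Measurable.ite (measurableSet_threshold_le ψ) (by fun_prop) (by fun_prop)

theorem measurable_thresholdZ' (ψ : ℝ) :
    Measurable fun x : (ℝ × ℝ) × I => thresholdZ' ψ x.1.1 x.1.2 x.2 :=
  Measurable.ite (measurableSet_threshold_le ψ) (by fun_prop) (by fun_prop)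

theorem measurable_maxLogPowDiv (ψ : ℝ) :
    Measurable fun x : (ℝ × ℝ) × I => maxLogPowDiv ψ x.1.1 x.1.2 x.2 := by
  unfold maxLogPowDiv logPowDiv
  fun_prop

theorem measurable_minLogPowDiv (ψ : ℝ) :
    Measurable fun x : (ℝ × ℝ) × I => minLogPowDiv ψ x.1.1 x.1.2 x.2 := by
  unfold minLogPowDiv logPowDiv
  fun_prop

/-! ### Integrability, independence and the law of large numbers -/

section Probability

variable {Ω E : Type*} [MeasurableSpace Ω] [MeasurableSpace E] {P : Measure Ω}

theorem integrable_of_ae_eq_or_eq {f g k : Ω → ℝ} (hf : Integrable f P) (hg : Integrable g P)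
    (hk : AEStronglyMeasurable k P) (hchoice : ∀ᵐ ω ∂P, k ω = f ω ∨ k ω = g ω) :
    Integrable k P := by
  refine (hf.abs.add hg.abs).mono' hk (hchoice.mono fun ω hω => ?_)
  rcases hω with hω | hω <;> rw [hω]
  exacts [le_add_of_nonneg_right (abs_nonneg _), le_add_of_nonneg_left (abs_nonneg _)]

theorem integrable_log_of_ae_mem_Icc [IsFiniteMeasure P] {A B : ℝ} (hA : 0 < A) {f : Ω → ℝ}
    (hf : AEMeasurable f P) (hf_mem : ∀ᵐ ω ∂P, f ω ∈ Set.Icc A B) :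
    Integrable (fun ω => Real.log (f ω)) P :=
  Integrable.of_mem_Icc (Real.log A) (Real.log B) hf.log <| hf_mem.mono fun _ hω =>
    ⟨Real.log_le_log hA hω.1, Real.log_le_log (hA.trans_le hω.1) hω.2⟩

theorem integrable_log_of_lintegral_rpow_neg {f : Ω → ℝ} (hf : AEMeasurable f P)
    (hf_mem : ∀ᵐ ω ∂P, f ω ∈ Set.Icc 0 1) {t : ℝ} (ht : 0 < t)
    (hmoment : ∫⁻ ω, ENNReal.ofReal (f ω) ^ (-t) ∂P < ⊤) :
    Integrable (fun ω => Real.log (f ω)) P := by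
  have hint := integrable_toReal_of_lintegral_ne_top
    (hf.ennreal_ofReal.pow_const (-t)) hmoment.ne
  refine (hint.div_const t).mono' hf.log.aestronglyMeasurable (hf_mem.mono fun ω hω => ?_)
  obtain ⟨hω_nonneg, hω_one⟩ := hω
  calc ‖Real.log (f ω)‖ = Real.log (f ω)⁻¹ := by
        rw [Real.norm_eq_abs, abs_of_nonpos (Real.log_nonpos hω_nonneg hω_one), Real.log_inv]
    _ ≤ (f ω)⁻¹ ^ t / t := Real.log_le_rpow_div (inv_nonneg.2 hω_nonneg) ht
    _ = (ENNReal.ofReal (f ω) ^ (-t)).toReal / t := by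
        rw [← ENNReal.toReal_rpow, ENNReal.toReal_ofReal hω_nonneg, Real.inv_rpow hω_nonneg,
          Real.rpow_neg hω_nonneg]

theorem ae_pos_of_lintegral_rpow_neg {f : Ω → ℝ} (hf : AEMeasurable f P) {t : ℝ} (ht : 0 < t)
    (hmoment : ∫⁻ ω, ENNReal.ofReal (f ω) ^ (-t) ∂P < ⊤) : ∀ᵐ ω ∂P, 0 < f ω := by
  filter_upwards [ae_lt_top' (hf.ennreal_ofReal.pow_const (-t)) hmoment.ne] with ω hω
  by_contra! hf_nonpos
  rw [ENNReal.ofReal_of_nonpos hf_nonpos, ENNReal.zero_rpow_of_neg (neg_lt_zero.2 ht)] at hω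
  exact lt_irrefl _ hω

theorem indepFun_of_forall_measure_inter_preimage_prod [IsZeroOrProbabilityMeasure P]
    {α β γ δ : Type*} [MeasurableSpace α] [MeasurableSpace β] [MeasurableSpace γ]
    [MeasurableSpace δ] {f : Ω → α × β} {g : Ω → γ × δ} (hf : Measurable f) (hg : Measurable g)
    (hfg : ∀ s t s' t', MeasurableSet s → MeasurableSet t → MeasurableSet s' →
      MeasurableSet t' → P (f ⁻¹' s ×ˢ t ∩ g ⁻¹' s' ×ˢ t')
        = P (f ⁻¹' s ×ˢ t) * P (g ⁻¹' s' ×ˢ t')) :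
    IndepFun f g P := by
  refine IndepSets.indep hf.comap_le hg.comap_le (isPiSystem_prod.comap f)
    (isPiSystem_prod.comap g) ?_ ?_ ?_
  · rw [← generateFrom_prod, MeasurableSpace.comap_generateFrom]
    rfl
  · rw [← generateFrom_prod, MeasurableSpace.comap_generateFrom]
    rfl
  · rw [IndepSets_iff]
    rintro _ _ ⟨_, ⟨s, hs, t, ht, rfl⟩, rfl⟩ ⟨_, ⟨s', hs', t', ht', rfl⟩, rfl⟩
    exact hfg s t s' t' hs ht hs' ht'

theorem indepFun_prodMk_of_indepFun_prodMk [IsZeroOrProbabilityMeasure P] {α β : Type*}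
    [MeasurableSpace α] [MeasurableSpace β] {X X' : Ω → α} {Y Y' : Ω → β} (hX : Measurable X)
    (hX' : Measurable X') (hY : Measurable Y) (hY' : Measurable Y') (hXX' : IndepFun X X' P)
    (hYY' : IndepFun Y Y' P)
    (hXY : IndepFun (fun ω => (X ω, X' ω)) (fun ω => (Y ω, Y' ω)) P) :
    IndepFun (fun ω => (X ω, Y ω)) (fun ω => (X' ω, Y' ω)) P := by
  refine indepFun_of_forall_measure_inter_preimage_prod (hX.prodMk hY) (hX'.prodMk hY')
    fun s t s' t' hs ht hs' ht' => ?_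
  have hX_inter : P (X ⁻¹' s ∩ X' ⁻¹' s') = P (X ⁻¹' s) * P (X' ⁻¹' s') :=
    hXX'.measure_inter_preimage_eq_mul _ _ hs hs'
  have hY_inter : P (Y ⁻¹' t ∩ Y' ⁻¹' t') = P (Y ⁻¹' t) * P (Y' ⁻¹' t') :=
    hYY'.measure_inter_preimage_eq_mul _ _ ht ht'
  have hXY_inter : P ((X ⁻¹' s ∩ X' ⁻¹' s') ∩ (Y ⁻¹' t ∩ Y' ⁻¹' t'))
      = P (X ⁻¹' s ∩ X' ⁻¹' s') * P (Y ⁻¹' t ∩ Y' ⁻¹' t') :=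
    hXY.measure_inter_preimage_eq_mul _ _ (hs.prod hs') (ht.prod ht')
  have hfirst : P (X ⁻¹' s ∩ Y ⁻¹' t) = P (X ⁻¹' s) * P (Y ⁻¹' t) :=
    (hXY.comp measurable_fst measurable_fst).measure_inter_preimage_eq_mul _ _ hs ht
  have hsecond : P (X' ⁻¹' s' ∩ Y' ⁻¹' t') = P (X' ⁻¹' s') * P (Y' ⁻¹' t') :=
    (hXY.comp measurable_snd measurable_snd).measure_inter_preimage_eq_mul _ _ hs' ht'
  simp only [Set.mk_preimage_prod]
  rw [Set.inter_inter_inter_comm, hXY_inter, hX_inter, hY_inter, hfirst, hsecond,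
    mul_mul_mul_comm]

theorem ae_tendsto_average {X : ℕ → Ω → E} (hindep : Pairwise fun i j => IndepFun (X i) (X j) P)
    (hident : ∀ n, IdentDistrib (X n) (X 0) P P) {f : E → ℝ} (hf : Measurable f)
    (hint : Integrable (fun ω => f (X 0 ω)) P) :
    ∀ᵐ ω ∂P, Tendsto (fun n : ℕ => (∑ i ∈ Finset.range n, f (X i ω)) / n) atTop
      (𝓝 (∫ ω, f (X 0 ω) ∂P)) :=
  strong_law_ae_real (fun n ω => f (X n ω)) hint (fun _ _ hij => (hindep hij).comp hf hf)
    fun n => (hident n).comp hf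

theorem ae_forall_mem_of_identDistrib {X : ℕ → Ω → E}
    (hident : ∀ n, IdentDistrib (X n) (X 0) P P) {s : Set E} (hs : MeasurableSet s)
    (hX : ∀ᵐ ω ∂P, X 0 ω ∈ s) : ∀ᵐ ω ∂P, ∀ n, X n ω ∈ s :=
  ae_all_iff.2 fun n => (hident n).symm.ae_mem_snd hs hX

theorem integral_div_integral_lt_iff {Y Z : Ω → ℝ} {ψ : ℝ} (hY : Integrable Y P)
    (hZ : Integrable Z P) (hZ_neg : ∫ ω, Z ω ∂P < 0) :
    (∫ ω, Y ω ∂P) / (∫ ω, Z ω ∂P) < ψ ↔ ∫ ω, (ψ * Z ω - Y ω) ∂P < 0 := by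
  rw [div_lt_iff_of_neg hZ_neg, integral_sub (hZ.const_mul ψ) hY, integral_const_mul, sub_neg]

theorem lt_integral_div_integral_iff {Y Z : Ω → ℝ} {ψ : ℝ} (hY : Integrable Y P)
    (hZ : Integrable Z P) (hZ_neg : ∫ ω, Z ω ∂P < 0) :
    ψ < (∫ ω, Y ω ∂P) / (∫ ω, Z ω ∂P) ↔ 0 < ∫ ω, (ψ * Z ω - Y ω) ∂P := by
  rw [lt_div_iff_of_neg hZ_neg, integral_sub (hZ.const_mul ψ) hY, integral_const_mul, sub_pos]

end Probability

/-! ### The random Moran construction -/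

/-- The law of one step of the random Moran construction, given by the ratios `a`, `b` of the left
and right child and the proportion `p` of mass handed to the left child: the ratios lie in the
region fixed by `A` and `B`, both children get positive mass, and the logarithms of their masses
have finite expectation. Everything is required almost surely only, so that the notion depends on
the joint law of `a`, `b`, `p` alone. -/
structure IsMoranStep {Ω : Type*} [MeasurableSpace Ω] (P : Measure Ω) (A B : ℝ) (a b : Ω → ℝ)
    (p : Ω → I) : Prop where
  pos : 0 < A
  lt_one : B < 1
  aemeasurable : AEMeasurable (fun ω => ((a ω, b ω), p ω)) P
  ae_range : ∀ᵐ ω ∂P, A ≤ min (a ω) (b ω) ∧ a ω + b ω ≤ B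
  ae_mem_Ioo : ∀ᵐ ω ∂P, (p ω : ℝ) ∈ Set.Ioo 0 1
  integrable_log : Integrable (fun ω => Real.log (p ω)) P
  integrable_log_one_sub : Integrable (fun ω => Real.log (1 - p ω)) P

namespace IsMoranStep

variable {Ω : Type*} [MeasurableSpace Ω] {P : Measure Ω} {A B : ℝ} {a b : Ω → ℝ} {p : Ω → I}
  (h : IsMoranStep P A B a b p)
include h

theorem ae_mem_Icc_left : ∀ᵐ ω ∂P, a ω ∈ Set.Icc A B := by
  filter_upwards [h.ae_range] with ω ⟨hmin, hadd⟩
  obtain ⟨ha, hb⟩ := le_min_iff.1 hmin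
  exact ⟨ha, by linarith [h.pos]⟩

theorem ae_mem_Icc_right : ∀ᵐ ω ∂P, b ω ∈ Set.Icc A B := by
  filter_upwards [h.ae_range] with ω ⟨hmin, hadd⟩
  obtain ⟨ha, hb⟩ := le_min_iff.1 hmin
  exact ⟨hb, by linarith [h.pos]⟩

theorem integrable_thresholdY (ψ : ℝ) :
    Integrable (fun ω => thresholdY ψ (a ω) (b ω) (p ω)) P :=
  integrable_of_ae_eq_or_eq h.integrable_log h.integrable_log_one_sub
    ((measurable_thresholdY ψ).comp_aemeasurable h.aemeasurable).aestronglyMeasurable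
    (ae_of_all _ fun _ => ite_eq_or_eq ..)

theorem integrable_thresholdY' (ψ : ℝ) :
    Integrable (fun ω => thresholdY' ψ (a ω) (b ω) (p ω)) P :=
  integrable_of_ae_eq_or_eq h.integrable_log h.integrable_log_one_sub
    ((measurable_thresholdY' ψ).comp_aemeasurable h.aemeasurable).aestronglyMeasurable
    (ae_of_all _ fun _ => ite_eq_or_eq ..)

theorem ae_mul_thresholdZ_sub_thresholdY_eq (ψ : ℝ) :
    (fun ω => ψ * thresholdZ ψ (a ω) (b ω) (p ω) - thresholdY ψ (a ω) (b ω) (p ω))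
      =ᵐ[P] fun ω => maxLogPowDiv ψ (a ω) (b ω) (p ω) := by
  filter_upwards [h.ae_mem_Icc_left, h.ae_mem_Icc_right, h.ae_mem_Ioo] with ω ha hb hp
  exact mul_thresholdZ_sub_thresholdY (h.pos.trans_le ha.1) (h.pos.trans_le hb.1) hp

theorem ae_mul_thresholdZ'_sub_thresholdY'_eq (ψ : ℝ) :
    (fun ω => ψ * thresholdZ' ψ (a ω) (b ω) (p ω) - thresholdY' ψ (a ω) (b ω) (p ω))
      =ᵐ[P] fun ω => minLogPowDiv ψ (a ω) (b ω) (p ω) := by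
  filter_upwards [h.ae_mem_Icc_left, h.ae_mem_Icc_right, h.ae_mem_Ioo] with ω ha hb hp
  exact mul_thresholdZ'_sub_thresholdY' (h.pos.trans_le ha.1) (h.pos.trans_le hb.1) hp

section IsFiniteMeasure

variable [IsFiniteMeasure P]

theorem integrable_log_left : Integrable (fun ω => Real.log (a ω)) P :=
  integrable_log_of_ae_mem_Icc h.pos h.aemeasurable.fst.fst h.ae_mem_Icc_left

theorem integrable_log_right : Integrable (fun ω => Real.log (b ω)) P :=
  integrable_log_of_ae_mem_Icc h.pos h.aemeasurable.fst.snd h.ae_mem_Icc_right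

theorem integrable_thresholdZ (ψ : ℝ) :
    Integrable (fun ω => thresholdZ ψ (a ω) (b ω) (p ω)) P :=
  integrable_of_ae_eq_or_eq h.integrable_log_left h.integrable_log_right
    ((measurable_thresholdZ ψ).comp_aemeasurable h.aemeasurable).aestronglyMeasurable
    (ae_of_all _ fun _ => ite_eq_or_eq ..)

theorem integrable_thresholdZ' (ψ : ℝ) :
    Integrable (fun ω => thresholdZ' ψ (a ω) (b ω) (p ω)) P :=
  integrable_of_ae_eq_or_eq h.integrable_log_left h.integrable_log_right
    ((measurable_thresholdZ' ψ).comp_aemeasurable h.aemeasurable).aestronglyMeasurable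
    (ae_of_all _ fun _ => ite_eq_or_eq ..)

theorem integrable_maxLogPowDiv (ψ : ℝ) :
    Integrable (fun ω => maxLogPowDiv ψ (a ω) (b ω) (p ω)) P :=
  (((h.integrable_thresholdZ ψ).const_mul ψ).sub (h.integrable_thresholdY ψ)).congr
    (h.ae_mul_thresholdZ_sub_thresholdY_eq ψ)

theorem integrable_minLogPowDiv (ψ : ℝ) :
    Integrable (fun ω => minLogPowDiv ψ (a ω) (b ω) (p ω)) P :=
  (((h.integrable_thresholdZ' ψ).const_mul ψ).sub (h.integrable_thresholdY' ψ)).congr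
    (h.ae_mul_thresholdZ'_sub_thresholdY'_eq ψ)

end IsFiniteMeasure

section IsProbabilityMeasure

variable [IsProbabilityMeasure P]

theorem integral_neg_of_ae_eq_log_or_eq_log {Z : Ω → ℝ} (hZ : Integrable Z P)
    (hchoice : ∀ᵐ ω ∂P, Z ω = Real.log (a ω) ∨ Z ω = Real.log (b ω)) : ∫ ω, Z ω ∂P < 0 := by
  have hB : 0 < B := by
    obtain ⟨ω, ha⟩ := h.ae_mem_Icc_left.exists
    exact h.pos.trans_le (ha.1.trans ha.2)
  have hZ_le : ∀ᵐ ω ∂P, Z ω ≤ Real.log B := by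
    filter_upwards [hchoice, h.ae_mem_Icc_left, h.ae_mem_Icc_right] with ω hω ha hb
    rcases hω with hω | hω <;> rw [hω]
    exacts [Real.log_le_log (h.pos.trans_le ha.1) ha.2, Real.log_le_log (h.pos.trans_le hb.1) hb.2]
  calc ∫ ω, Z ω ∂P ≤ ∫ _, Real.log B ∂P := integral_mono_ae hZ (integrable_const _) hZ_le
    _ = Real.log B := by simp only [integral_const, probReal_univ, one_smul]
    _ < 0 := Real.log_neg hB h.lt_one

theorem thresholdG_lt_iff (ψ : ℝ) :
    thresholdG P a b p ψ < ψ ↔ ∫ ω, maxLogPowDiv ψ (a ω) (b ω) (p ω) ∂P < 0 := by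
  have hZ_neg := h.integral_neg_of_ae_eq_log_or_eq_log (h.integrable_thresholdZ ψ)
    (ae_of_all _ fun _ => ite_eq_or_eq ..)
  rw [thresholdG, integral_div_integral_lt_iff (h.integrable_thresholdY ψ)
    (h.integrable_thresholdZ ψ) hZ_neg, integral_congr_ae (h.ae_mul_thresholdZ_sub_thresholdY_eq ψ)]

theorem lt_thresholdG'_iff (ψ : ℝ) :
    ψ < thresholdG' P a b p ψ ↔ 0 < ∫ ω, minLogPowDiv ψ (a ω) (b ω) (p ω) ∂P := by
  have hZ_neg := h.integral_neg_of_ae_eq_log_or_eq_log (h.integrable_thresholdZ' ψ)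
    (ae_of_all _ fun _ => ite_eq_or_eq ..)
  rw [thresholdG', lt_integral_div_integral_iff (h.integrable_thresholdY' ψ)
    (h.integrable_thresholdZ' ψ) hZ_neg,
    integral_congr_ae (h.ae_mul_thresholdZ'_sub_thresholdY'_eq ψ)]

theorem le_thresholdG_iff (ψ : ℝ) :
    ψ ≤ thresholdG P a b p ψ ↔ 0 ≤ ∫ ω, maxLogPowDiv ψ (a ω) (b ω) (p ω) ∂P :=
  le_iff_le_iff_lt_iff_lt.2 (h.thresholdG_lt_iff ψ)

theorem thresholdG'_le_iff (ψ : ℝ) :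
    thresholdG' P a b p ψ ≤ ψ ↔ ∫ ω, minLogPowDiv ψ (a ω) (b ω) (p ω) ∂P ≤ 0 :=
  le_iff_le_iff_lt_iff_lt.2 (h.lt_thresholdG'_iff ψ)

end IsProbabilityMeasure

end IsMoranStep

namespace IsMoranStep

variable {Ω : Type*} [MeasurableSpace Ω] {P : Measure Ω} {A B : ℝ} {a b : ℕ → Ω → ℝ}
  {p : ℕ → Ω → I} (h : IsMoranStep P A B (a 0) (b 0) (p 0))
  (hident : ∀ n, IdentDistrib (fun ω => ((a n ω, b n ω), p n ω))
    (fun ω => ((a 0 ω, b 0 ω), p 0 ω)) P P)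
include h hident

theorem ae_moranBounds : ∀ᵐ ω ∂P, MoranBounds A B (fun n => a n ω) (fun n => b n ω) := by
  have hmeas : MeasurableSet ({x : (ℝ × ℝ) × I | A ≤ min x.1.1 x.1.2} ∩
      {x : (ℝ × ℝ) × I | x.1.1 + x.1.2 ≤ B}) :=
    (measurableSet_le (by fun_prop) (by fun_prop)).inter
      (measurableSet_le (by fun_prop) (by fun_prop))
  filter_upwards [ae_forall_mem_of_identDistrib hident hmeas h.ae_range] with ω hω
  exact ⟨h.pos, h.lt_one, fun n => (hω n).1, fun n => (hω n).2⟩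

theorem ae_forall_mem_Ioo : ∀ᵐ ω ∂P, ∀ n, (p n ω : ℝ) ∈ Set.Ioo 0 1 :=
  ae_forall_mem_of_identDistrib hident (s := {x : (ℝ × ℝ) × I | (x.2 : ℝ) ∈ Set.Ioo 0 1})
    (measurableSet_Ioo.preimage (by fun_prop)) h.ae_mem_Ioo

end IsMoranStep

theorem isMoranStep_of_lintegral_rpow_neg {Ω : Type*} [MeasurableSpace Ω] {P : Measure Ω}
    {A B : ℝ} {a b : Ω → ℝ} {p : Ω → I} (hA : 0 < A) (hB : B < 1)
    (hab_meas : AEMeasurable (fun ω => (a ω, b ω)) P) (hp_meas : AEMeasurable p P)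
    (hab_range : ∀ᵐ ω ∂P, A ≤ min (a ω) (b ω) ∧ a ω + b ω ≤ B) {t : ℝ} (ht : 0 < t)
    (hp_moment : ∫⁻ ω, ENNReal.ofReal (p ω) ^ (-t) ∂P < ⊤)
    (hq_moment : ∫⁻ ω, ENNReal.ofReal (1 - (p ω : ℝ)) ^ (-t) ∂P < ⊤) :
    IsMoranStep P A B a b p where
  pos := hA
  lt_one := hB
  aemeasurable := hab_meas.prodMk hp_meas
  ae_range := hab_range
  ae_mem_Ioo := by
    filter_upwards [ae_pos_of_lintegral_rpow_neg (by fun_prop) ht hp_moment,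
      ae_pos_of_lintegral_rpow_neg (by fun_prop) ht hq_moment] with ω hp hq
    exact ⟨hp, sub_pos.1 hq⟩
  integrable_log := integrable_log_of_lintegral_rpow_neg (by fun_prop)
    (ae_of_all _ fun ω => (p ω).2) ht hp_moment
  integrable_log_one_sub := integrable_log_of_lintegral_rpow_neg (by fun_prop)
    (ae_of_all _ fun ω => Set.Icc.one_sub_mem (p ω).2) ht hq_moment

theorem mainTheorem8_general {Ω : Type*} [MeasurableSpace Ω] (P : Measure Ω)
    [IsProbabilityMeasure P] {A B : ℝ} {a b : ℕ → Ω → ℝ} {p : ℕ → Ω → I}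
    (hstep : IsMoranStep P A B (a 0) (b 0) (p 0))
    (hindep : Pairwise fun i j =>
      IndepFun (fun ω => ((a i ω, b i ω), p i ω)) (fun ω => ((a j ω, b j ω), p j ω)) P)
    (hident : ∀ n, IdentDistrib (fun ω => ((a n ω, b n ω), p n ω))
      (fun ω => ((a 0 ω, b 0 ω), p 0 ω)) P P)
    (ψ : ℝ) :
    (thresholdG P (a 0) (b 0) (p 0) ψ < ψ →
      ∀ᵐ ω ∂P, quasiAssouadDim (moranMeasure (fun n => a n ω) (fun n => b n ω) (fun n => p n ω))
        ≤ (ψ : EReal)) ∧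
    (ψ ≤ thresholdG P (a 0) (b 0) (p 0) ψ →
      ∀ᵐ ω ∂P, (ψ : EReal)
        ≤ quasiAssouadDim (moranMeasure (fun n => a n ω) (fun n => b n ω) (fun n => p n ω))) ∧
    (ψ < thresholdG' P (a 0) (b 0) (p 0) ψ →
      ∀ᵐ ω ∂P, (ψ : EReal)
        ≤ quasiLowerAssouadDim
            (moranMeasure (fun n => a n ω) (fun n => b n ω) (fun n => p n ω))) ∧
    (thresholdG' P (a 0) (b 0) (p 0) ψ ≤ ψ →
      ∀ᵐ ω ∂P, quasiLowerAssouadDim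
          (moranMeasure (fun n => a n ω) (fun n => b n ω) (fun n => p n ω))
        ≤ (ψ : EReal)) := by
  have hmax := ae_tendsto_average hindep hident (measurable_maxLogPowDiv ψ)
    (hstep.integrable_maxLogPowDiv ψ)
  have hmin := ae_tendsto_average hindep hident (measurable_minLogPowDiv ψ)
    (hstep.integrable_minLogPowDiv ψ)
  have hab := hstep.ae_moranBounds hident
  have hp := hstep.ae_forall_mem_Ioo hident
  rw [hstep.thresholdG_lt_iff, hstep.le_thresholdG_iff, hstep.lt_thresholdG'_iff,
    hstep.thresholdG'_le_iff]
  refine ⟨fun hsign => ?_, fun hsign => ?_, fun hsign => ?_, fun hsign => ?_⟩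
  · filter_upwards [hab, hp, hmax] with ω hab hp hmax
    exact hab.quasiAssouadDim_le hp hmax hsign
  · filter_upwards [hab, hp, hmax] with ω hab hp hmax
    exact hab.le_quasiAssouadDim hp hmax hsign
  · filter_upwards [hab, hp, hmin] with ω hab hp hmin
    exact hab.le_quasiLowerAssouadDim hp hmin hsign
  · filter_upwards [hab, hp, hmin] with ω hab hp hmin
    exact hab.quasiLowerAssouadDim_le hp hmin hsign

theorem mainTheorem8 {Ω : Type*} [MeasurableSpace Ω] (P : Measure Ω) [IsProbabilityMeasure P]
    (A B : ℝ) (hA : 0 < A) (hAB : A < B) (hB : B < 1)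
    (a b : ℕ → Ω → ℝ) (p : ℕ → Ω → I)
    -- the scaling ratios: measurable, in the prescribed region, and i.i.d. as pairs
    (hab_meas : ∀ n, Measurable (fun ω => (a n ω, b n ω)))
    (hab_range : ∀ n ω, A ≤ min (a n ω) (b n ω) ∧ a n ω + b n ω ≤ B)
    (hab_indep : iIndepFun (fun n ω => (a n ω, b n ω)) P)
    (hab_ident : ∀ n, IdentDistrib (fun ω => (a n ω, b n ω)) (fun ω => (a 0 ω, b 0 ω)) P P)
    -- the probabilities: measurable, i.i.d., and independent of the scaling ratios
    (hp_meas : ∀ n, Measurable (p n))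
    (hp_indep : iIndepFun p P)
    (hp_ident : ∀ n, IdentDistrib (p n) (p 0) P P)
    (hp_ab : IndepFun (fun ω n => p n ω) (fun ω n => (a n ω, b n ω)) P)
    -- `𝔼[p^{-t}] < ∞` and `𝔼[(1-p)^{-t}] < ∞` for some `t > 0`, with `0^{-t} = ∞`
    (hp_moment : ∃ t : ℝ, 0 < t ∧
      (∫⁻ ω, ENNReal.ofReal (p 0 ω) ^ (-t) ∂P) < ⊤ ∧
      (∫⁻ ω, ENNReal.ofReal (1 - (p 0 ω : ℝ)) ^ (-t) ∂P) < ⊤)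
    (ψ : ℝ) (hψ : 0 ≤ ψ) :
    (thresholdG P (a 0) (b 0) (p 0) ψ < ψ →
      ∀ᵐ ω ∂P, quasiAssouadDim (moranMeasure (fun n => a n ω) (fun n => b n ω) (fun n => p n ω))
        ≤ (ψ : EReal)) ∧
    (ψ ≤ thresholdG P (a 0) (b 0) (p 0) ψ →
      ∀ᵐ ω ∂P, (ψ : EReal)
        ≤ quasiAssouadDim (moranMeasure (fun n => a n ω) (fun n => b n ω) (fun n => p n ω))) ∧
    (ψ < thresholdG' P (a 0) (b 0) (p 0) ψ →
      ∀ᵐ ω ∂P, (ψ : EReal)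
        ≤ quasiLowerAssouadDim
            (moranMeasure (fun n => a n ω) (fun n => b n ω) (fun n => p n ω))) ∧
    (thresholdG' P (a 0) (b 0) (p 0) ψ ≤ ψ →
      ∀ᵐ ω ∂P, quasiLowerAssouadDim
          (moranMeasure (fun n => a n ω) (fun n => b n ω) (fun n => p n ω))
        ≤ (ψ : EReal)) := by
  obtain ⟨t, ht, hp_moment, hq_moment⟩ := hp_moment
  refine mainTheorem8_general P
    (isMoranStep_of_lintegral_rpow_neg hA hB (hab_meas 0).aemeasurable (hp_meas 0).aemeasurable
      (ae_of_all _ (hab_range 0)) ht hp_moment hq_moment)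
    (fun i j hij => ?_) (fun n => ?_) ψ
  · exact indepFun_prodMk_of_indepFun_prodMk (hab_meas i) (hab_meas j) (hp_meas i) (hp_meas j)
      (hab_indep.indepFun hij) (hp_indep.indepFun hij)
      (hp_ab.symm.comp ((measurable_pi_apply i).prodMk (measurable_pi_apply j))
        ((measurable_pi_apply i).prodMk (measurable_pi_apply j)))
  · have hab_p : ∀ k, IndepFun (fun ω => (a k ω, b k ω)) (p k) P := fun k =>
      hp_ab.symm.comp (measurable_pi_apply k) (measurable_pi_apply k)
    exact (hab_ident n).prodMk (hp_ident n) (hab_p n) (hab_p 0)
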